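/- **Setting.** Let $(\mathcal X,\mathcal A)$ be a measurable space, $P_0,P_1$ probability measures on it, and $g:\mathcal X\to\{0,1\}$ a measurable classifier. Write $p_\theta[m]=\mathbb P_{X\sim P_\theta}(g(X)=m)$ and suppose that $p_0=[1-e^{-1},e^{-1}]$ and $p_1=[0.1,0.9]$. Put $\Delta_1=p_1[1]-p_1[0]=0.8$. Let $X_1,X_2,\dots$ be independent observations and $\mathcal F_n=\sigma(g(X_1),\dots,g(X_n))$; stopping times take values in $\mathbb N\cup\{\infty\}$ and are with respect to $(\mathcal F_n)_{n\ge0}$. Let $\mathbb P_\theta,\mathbb E_\theta$ refer to $X_t\overset{iid}{\sim}P_\theta$ for all $t$, write $\mathbb E_\infty=\mathbb E_0$ (no change), and let $\mathbb E_{T,1}$ refer to a change at time $T\ge1$: $X_t\sim P_0$ for $t<T$ and $X_t\sim P_1$ for $t\ge T$. The worst-case conditional detection delay of a stopping time $\tau$ is $$\mathrm{D}(\tau)=\sup_{T\ge1}\operatorname{ess\,sup}\,\mathbb E_{T,1}\big[(\tau-T)^+\mid\mathcal F_T\big]\in[0,\infty].$$ For $0\le k\le n$ define the wealth of the betting process started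 after time $k$ by $$W^{(k)}_n=\int_{-1}^0\prod_{t=k+1}^n\Big(1+\lambda\big(\mathbf 1_{g(X_t)=0}-\mathbf 1_{g(X_t)=\hat\jmath^{(k)}_t}\big)\Big)\,d\lambda ,$$ where $\hat\jmath^{(k)}_t$ is an index maximizing the empirical distribution of $g(X_{k+1}),\dots,g(X_{t-1})$ (the uniform distribution $[1/2,1/2]$ if $t=k+1$), ties being broken by an arbitrary fixed deterministic rule depending on the empirical distribution. For $\alpha\in(0,1)$ let $$\tau^{\rm test}_\alpha=\inf\{n\ge1: W^{(0)}_n\ge1/\alpha\},\qquad \tau^{\rm det}_\alpha=\inf\Big\{n\ge1:\max_{0\le k<n}W^{(k)}_n\ge1/\alpha\Big\}.$$ **Proposition (optimality in some cases).** There are constants $c,C>0$ and $\alpha_0\in(0,1)$, not depending on $\mathcal X,P_0,P_1,g$ or the tie-breaking rule, such that for all $\alpha\in(0,\alpha_0)$: 1. every stopping time $\tau$ with $\mathbb E_\infty[\tau]\ge1/\alpha$ satisfies $\mathrm D(\tau)\ge c\,\dfrac{\log(1/\alpha)}{\Delta_1^2}$; 2. $\tau^{\rm det}_\alpha$ is a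 stopping time with $\mathbb E_\infty[\tau^{\rm det}_\alpha]\ge1/\alpha$ and $$c\,\frac{\log(1/(\alpha\Delta_1))}{\Delta_1^2}\le\mathrm D(\tau^{\rm det}_\alpha)\le C\,\frac{\log(1/(\alpha\Delta_1))}{\Delta_1^2};$$ 3. every stopping time $\tau$ with $\mathbb P_0(\tau<\infty)\le\alpha$ satisfies $\mathbb E_1[\tau]\ge c\,\dfrac{\log(1/\alpha)}{\Delta_1^2}$; 4. $\tau^{\rm test}_\alpha$ is a stopping time with $\mathbb P_0(\tau^{\rm test}_\alpha<\infty)\le\alpha$, $\mathbb P_1(\tau^{\rm test}_\alpha<\infty)=1$ and $$c\,\frac{\log(1/(\alpha\Delta_1))}{\Delta_1^2}\le\mathbb E_1[\tau^{\rm test}_\alpha]\le C\,\frac{\log(1/(\alpha\Delta_1))}{\Delta_1^2}.$$ Thus on this instance the delay bound $O(\log(1/(\alpha\Delta_1))/\Delta_1^2)$ for $\tau^{\rm det}_\alpha$ and the same bound on the expected stopping time of $\tau^{\rm test}_\alpha$ are asymptotically tight as $\alpha\to0$, and no detector (respectively test) with the same error control improves on their order. -/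

import Mathlib

open MeasureTheory ProbabilityTheory
open scoped ENNReal

namespace ClassifierDetection

noncomputable section

/-- `outputProb P g θ m` is `p_θ[m]`, the probability of `g(X) = m` when `X ∼ P_θ`. -/
def outputProb {𝒳 : Type*} [MeasurableSpace 𝒳] {L : ℕ} (P : Fin (L + 1) → Measure 𝒳)
    (g : 𝒳 → Fin (L + 1)) (θ m : Fin (L + 1)) : ℝ :=
  (P θ).real (g ⁻¹' {m})

/-- The gap `Δ_θ = p_θ[θ] - p_θ[0]`. -/
def gap {𝒳 : Type*} [MeasurableSpace 𝒳] {L : ℕ} (P : Fin (L + 1) → Measure 𝒳)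
    (g : 𝒳 → Fin (L + 1)) (θ : Fin (L + 1)) : ℝ :=
  outputProb P g θ θ - outputProb P g θ 0

/-! A sample path is `ω : ℕ → 𝒳`, where `ω t` is the observation `X_{t+1}`, so that `X_1, …, X_n`
are the values `ω t` with `t < n`. -/

/-- The law of independent observations with a change at time `T`:
`X_t ∼ P_0` for `t < T` and `X_t ∼ P_θ` for `t ≥ T`. -/
def changeLaw {𝒳 : Type*} [MeasurableSpace 𝒳] {L : ℕ} (P : Fin (L + 1) → Measure 𝒳)
    [∀ i, IsProbabilityMeasure (P i)] (θ : Fin (L + 1)) (T : ℕ) : Measure (ℕ → 𝒳) :=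
  Measure.infinitePi fun t : ℕ => P (if t + 1 < T then 0 else θ)

/-- The law of i.i.d. observations drawn from `P_θ`; for `θ = 0` this is also the law when no
change occurs (`T = ∞`). -/
def iidLaw {𝒳 : Type*} [MeasurableSpace 𝒳] {L : ℕ} (P : Fin (L + 1) → Measure 𝒳)
    [∀ i, IsProbabilityMeasure (P i)] (θ : Fin (L + 1)) : Measure (ℕ → 𝒳) :=
  Measure.infinitePi fun _ : ℕ => P θ

/-- The filtration generated by the classifier outputs: at time `n` it is
`σ(g(X_1), …, g(X_n))`. -/
def outputFiltration {𝒳 : Type*} [MeasurableSpace 𝒳] {L : ℕ} (g : 𝒳 → Fin (L + 1))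
    (hg : Measurable g) : Filtration ℕ (inferInstance : MeasurableSpace (ℕ → 𝒳)) where
  seq n := ⨆ (s : ℕ) (_ : s < n),
    MeasurableSpace.comap (fun ω : ℕ → 𝒳 => g (ω s)) inferInstance
  mono' _ _ hij := biSup_mono fun _ h => lt_of_lt_of_le h hij
  le' _ := iSup₂_le fun s _ => (hg.comp (measurable_pi_apply s)).comap_le

/-- Average run length to false alarm, `E_∞[τ]`. -/
def averageRunLength {𝒳 : Type*} [MeasurableSpace 𝒳] {L : ℕ} (P : Fin (L + 1) → Measure 𝒳)
    [∀ i, IsProbabilityMeasure (P i)] (τ : (ℕ → 𝒳) → ℕ∞) : ℝ≥0∞ :=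
  ∫⁻ ω, (τ ω : ℝ≥0∞) ∂(iidLaw P 0)

/-- Worst-case conditional detection delay
`sup_{T ≥ 1} ess sup E_{T,θ}[(τ - T)⁺ | σ(g(X_1), …, g(X_T))]`, with values in `[0, ∞]`
(subtraction in `[0, ∞]` is truncated at `0`). -/
def worstDelay {𝒳 : Type*} [MeasurableSpace 𝒳] {L : ℕ} (P : Fin (L + 1) → Measure 𝒳)
    [∀ i, IsProbabilityMeasure (P i)] (g : 𝒳 → Fin (L + 1)) (hg : Measurable g)
    (θ : Fin (L + 1)) (τ : (ℕ → 𝒳) → ℕ∞) : ℝ≥0∞ :=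
  ⨆ (T : ℕ) (_ : 1 ≤ T),
    essSup
      (condLExp (outputFiltration g hg T) (changeLaw P θ T)
        (fun ω => (τ ω : ℝ≥0∞) - (T : ℝ≥0∞)))
      (changeLaw P θ T)

/-- Change detectors with false-alarm control: stopping times of the classifier outputs with
`E_∞[τ] ≥ 1/α`. -/
def IsChangeDetector {𝒳 : Type*} [MeasurableSpace 𝒳] {L : ℕ} (P : Fin (L + 1) → Measure 𝒳)
    [∀ i, IsProbabilityMeasure (P i)] (g : 𝒳 → Fin (L + 1)) (hg : Measurable g)
    (α : ℝ) (τ : (ℕ → 𝒳) → ℕ∞) : Prop :=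
  IsStoppingTime (outputFiltration g hg) τ ∧ ENNReal.ofReal (1 / α) ≤ averageRunLength P τ

/-- Level-`α` sequential tests: stopping times of the classifier outputs with
`P_0(τ < ∞) ≤ α`. -/
def IsLevelTest {𝒳 : Type*} [MeasurableSpace 𝒳] {L : ℕ} (P : Fin (L + 1) → Measure 𝒳)
    [∀ i, IsProbabilityMeasure (P i)] (g : 𝒳 → Fin (L + 1)) (hg : Measurable g)
    (α : ℝ) (τ : (ℕ → 𝒳) → ℕ∞) : Prop :=
  IsStoppingTime (outputFiltration g hg) τ ∧ iidLaw P 0 {ω | τ ω < ⊤} ≤ ENNReal.ofReal α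

/-- Empirical distribution of the outputs `g(X_{k+1}), …, g(X_n)`; the uniform distribution if
there are none. -/
def empirical {𝒳 : Type*} {L : ℕ} (g : 𝒳 → Fin (L + 1)) (k n : ℕ) (ω : ℕ → 𝒳)
    (m : Fin (L + 1)) : ℝ :=
  if n ≤ k then 1 / ((L : ℝ) + 1)
  else (((Finset.Ico k n).filter fun s => g (ω s) = m).card : ℝ) / ((n : ℝ) - (k : ℝ))

/-- A deterministic rule that picks an index with the largest entry (ties broken in an arbitrary
deterministic manner). -/
def IsArgmaxRule {L : ℕ} (sel : (Fin (L + 1) → ℝ) → Fin (L + 1)) : Prop :=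
  ∀ (v : Fin (L + 1) → ℝ) (m : Fin (L + 1)), v m ≤ v (sel v)

/-- The bet `1{g(X_{t+1}) = 0} - 1{g(X_{t+1}) = ĵ}`, where `ĵ` is the most frequent label among
`g(X_{k+1}), …, g(X_t)`. -/
def payoff {𝒳 : Type*} {L : ℕ} (g : 𝒳 → Fin (L + 1)) (sel : (Fin (L + 1) → ℝ) → Fin (L + 1))
    (k t : ℕ) (ω : ℕ → 𝒳) : ℝ :=
  (if g (ω t) = 0 then 1 else 0) - (if g (ω t) = sel (empirical g k t ω) then 1 else 0)

/-- The mixture wealth at time `n` of the betting process started after time `k`, which uses the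
observations `X_{k+1}, …, X_n`. -/
def wealth {𝒳 : Type*} {L : ℕ} (g : 𝒳 → Fin (L + 1)) (sel : (Fin (L + 1) → ℝ) → Fin (L + 1))
    (k n : ℕ) (ω : ℕ → 𝒳) : ℝ :=
  ∫ l in (-1 : ℝ)..0, ∏ t ∈ Finset.Ico k n, (1 + l * payoff g sel k t ω)

/-- The sequential test `inf {n ≥ 1 : W_n ≥ 1/α}`. -/
def proposedTest {𝒳 : Type*} {L : ℕ} (g : 𝒳 → Fin (L + 1))
    (sel : (Fin (L + 1) → ℝ) → Fin (L + 1)) (α : ℝ) (ω : ℕ → 𝒳) : ℕ∞ :=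
  ⨅ (n : ℕ) (_ : 1 ≤ n ∧ 1 / α ≤ wealth g sel 0 n ω), (n : ℕ∞)

/-- The change detector `inf {n ≥ 1 : M_n ≥ 1/α}`, where `M_n` is the maximum of the wealths at
time `n` of the processes started at the observations `X_1, …, X_n`. -/
def proposedDetector {𝒳 : Type*} {L : ℕ} (g : 𝒳 → Fin (L + 1))
    (sel : (Fin (L + 1) → ℝ) → Fin (L + 1)) (α : ℝ) (ω : ℕ → 𝒳) : ℕ∞ :=
  ⨅ (n : ℕ) (_ : 1 ≤ n ∧ 1 / α ≤ ⨆ k : Fin n, wealth g sel k n ω), (n : ℕ∞)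

end

end ClassifierDetection

open ClassifierDetection

/-! Everything is reduced to the binary outputs `g (ω t)`, so events at time `n` are subsets of a
finite discrete space.

False alarms. Under `P 0` the output `0` is the likelier one and bets are nonpositive, so every
wealth is a nonnegative supermartingale (`setLIntegral_wealth_succ_le`). Optional stopping gives
Ville's inequality for the test. For the detector it is applied to the Shiryaev–Roberts sum of the
wealths started at times `k < n`, which dominates their maximum and drifts up by at most `1` per
step.

Upper bounds. With two labels the bettor either abstains or bets on label `1`. Abstaining requires
that zeros have been at least as frequent as ones, so its cost is at most a constant factor per
observed zero (`pow_mul_pow_le_betProduct`). Averaging over a short interval of bets bounds the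
inverse wealth by a product of independent weights (`one_le_wealth_mul_decay`) of mean below
`91/100` after the change. Hence wealth `1/α` is reached after O(log(1/α)) steps plus a geometric
tail, conditionally on the past (`setLIntegral_sub_le`).

Lower bounds. One post-change observation multiplies probabilities by at most `e` relative to no
change. A test that often stops under `P 1` within log(1/α)/2 steps would therefore have false-alarm
probability above `α`. A detector with small delay would stop in each window of that length with
conditional probability of order at least `α ^ (1/2)` under no change, so its run length would be
O(log(1/α) · `α ^ (-1/2)`), less than `1/α`.

Since the gap is the constant `4/5`, the factors involving it only affect `c` and `C`. -/

namespace ClassifierDetection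

/-! ### Events and functions determined by finitely many outputs -/

section Filtration

variable {𝒳 : Type*} {L : ℕ}

/-- The vector of the first `n` classifier outputs. -/
def outputs (g : 𝒳 → Fin (L + 1)) (n : ℕ) (ω : ℕ → 𝒳) (i : Fin n) : Fin (L + 1) := g (ω i)

theorem outputs_eq_iff {g : 𝒳 → Fin (L + 1)} {n : ℕ} {ω ω' : ℕ → 𝒳} :
    outputs g n ω = outputs g n ω' ↔ ∀ s < n, g (ω s) = g (ω' s) :=
  ⟨fun h s hs => congrFun h ⟨s, hs⟩, fun h => funext fun i => h i i.2⟩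

variable [MeasurableSpace 𝒳] {g : 𝒳 → Fin (L + 1)} (hg : Measurable g)

theorem comap_le_outputFiltration {n s : ℕ} (hs : s < n) :
    MeasurableSpace.comap (fun ω : ℕ → 𝒳 => g (ω s)) inferInstance ≤ outputFiltration g hg n :=
  le_iSup₂_of_le (f := fun (s : ℕ) (_ : s < n) =>
    MeasurableSpace.comap (fun ω : ℕ → 𝒳 => g (ω s)) inferInstance) s hs le_rfl

theorem measurable_outputs (n : ℕ) : Measurable[outputFiltration g hg n] (outputs g n) := by
  refine @measurable_pi_lambda _ _ _ (outputFiltration g hg n) _ _ fun i => ?_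
  exact measurable_iff_comap_le.2 (comap_le_outputFiltration hg i.2)

theorem outputFiltration_le_comap (n : ℕ) :
    outputFiltration g hg n ≤ MeasurableSpace.comap (outputs g n) ⊤ := by
  refine iSup₂_le fun s hs => ?_
  rintro _ ⟨t, -, rfl⟩
  exact ⟨{y | y ⟨s, hs⟩ ∈ t}, trivial, rfl⟩

/-- A set of paths is determined by the first `n` outputs if it is measurable at time `n`. -/
theorem eq_preimage_outputs {n : ℕ} {A : Set (ℕ → 𝒳)}
    (hA : MeasurableSet[outputFiltration g hg n] A) :
    ∃ S : Set (Fin n → Fin (L + 1)), A = outputs g n ⁻¹' S := by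
  obtain ⟨S, -, h⟩ := outputFiltration_le_comap hg n A hA
  exact ⟨S, h.symm⟩

/-- A function of the first `n` outputs is measurable at time `n`. -/
theorem measurable_of_outputs {β : Type*} [MeasurableSpace β] {n : ℕ} {f : (ℕ → 𝒳) → β}
    (hf : ∀ ω ω', (∀ s < n, g (ω s) = g (ω' s)) → f ω = f ω') :
    Measurable[outputFiltration g hg n] f := by
  intro s _
  -- The set is saturated for `outputs g n`, whose target is finite and discrete, so no
  -- measurability of `s` is needed.
  have h : f ⁻¹' s = outputs g n ⁻¹' (outputs g n '' (f ⁻¹' s)) := by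
    refine Set.Subset.antisymm (Set.subset_preimage_image _ _) ?_
    rintro ω ⟨ω', h', h⟩
    rw [Set.mem_preimage, ← hf ω' ω (outputs_eq_iff.1 h)]
    exact h'
  rw [h]
  exact measurable_outputs hg n (Set.toFinite _).measurableSet

theorem measurableSet_of_outputs {n : ℕ} {A : Set (ℕ → 𝒳)}
    (hA : ∀ ω ω', (∀ s < n, g (ω s) = g (ω' s)) → (ω ∈ A ↔ ω' ∈ A)) :
    MeasurableSet[outputFiltration g hg n] A := by
  have := measurable_of_outputs (β := Prop) hg (f := fun ω => ω ∈ A)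
    fun ω ω' h => propext (hA ω ω' h)
  exact @measurableSet_setOfPred _ (outputFiltration g hg n) _ |>.2 this

theorem measurableSet_lt_stoppingTime {τ : (ℕ → 𝒳) → ℕ∞}
    (hτ : IsStoppingTime (outputFiltration g hg) τ) (n : ℕ) :
    MeasurableSet[outputFiltration g hg n] {ω | (n : ℕ∞) < τ ω} := by
  have h : {ω | (n : ℕ∞) < τ ω} = {ω | τ ω ≤ (n : ℕ∞)}ᶜ := by
    ext ω; simp
  rw [h]
  exact (hτ n).compl

theorem measurable_stoppingTime {τ : (ℕ → 𝒳) → ℕ∞}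
    (hτ : IsStoppingTime (outputFiltration g hg) τ) :
    Measurable fun ω => (τ ω : ℝ≥0∞) := by
  have h : ∀ n : ℕ, MeasurableSet {ω | τ ω ≤ (n : ℕ∞)} := fun n =>
    (outputFiltration g hg).le n _ (hτ n)
  refine measurable_of_Iic fun x => ?_
  have hx : (fun ω => (τ ω : ℝ≥0∞)) ⁻¹' Set.Iic x =
      if x = ⊤ then Set.univ else {ω | τ ω ≤ (⌊x.toReal⌋₊ : ℕ∞)} := by
    split_ifs with hx
    · simp [hx]
    ext ω
    simp only [Set.mem_preimage, Set.mem_Iic, Set.mem_ofPred_eq]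
    induction τ ω with
    | top => simp [hx]
    | coe n =>
      rw [ENat.toENNReal_coe, Nat.cast_le, Nat.le_floor_iff ENNReal.toReal_nonneg,
        ← ENNReal.ofReal_natCast, ENNReal.ofReal_le_iff_le_toReal hx]
  rw [hx]
  split_ifs
  exacts [.univ, h _]

end Filtration

/-! ### Independence and likelihood ratios for product laws -/

section Product

variable {𝒳 : Type*} [MeasurableSpace 𝒳] {L : ℕ} {g : 𝒳 → Fin (L + 1)} (hg : Measurable g)
  (Q : ℕ → Measure 𝒳) [∀ t, IsProbabilityMeasure (Q t)]

/-- The next output is independent of the past. -/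
theorem lintegral_mul_indicator_output {n : ℕ} {f : (ℕ → 𝒳) → ℝ≥0∞}
    (hf : Measurable[outputFiltration g hg n] f) (j : Fin (L + 1)) :
    ∫⁻ ω, f ω * (if g (ω n) = j then 1 else 0) ∂(Measure.infinitePi Q) =
      (∫⁻ ω, f ω ∂(Measure.infinitePi Q)) * Q n (g ⁻¹' {j}) := by
  have hX : ∀ s : ℕ, Measurable fun ω : ℕ → 𝒳 => g (ω s) := fun s =>
    hg.comp (measurable_pi_apply s)
  have hind := indep_iSup_of_disjoint (S := Set.Iio n) (T := {n}) (fun s => (hX s).comap_le)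
    (iIndepFun_infinitePi (P := Q) (X := fun _ => g) (fun _ => hg)).iIndep (by simp)
  have hle : (⨆ i ∈ ({n} : Set ℕ), MeasurableSpace.comap (fun ω : ℕ → 𝒳 => g (ω i))
      inferInstance) = MeasurableSpace.comap (fun ω : ℕ → 𝒳 => g (ω n)) inferInstance := iSup_singleton
  have hlt : (⨆ i ∈ Set.Iio n, MeasurableSpace.comap (fun ω : ℕ → 𝒳 => g (ω i))
      inferInstance) = outputFiltration g hg n := rfl
  rw [hle, hlt] at hind
  rw [lintegral_mul_eq_lintegral_mul_lintegral_of_independent_measurableSpace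
    ((outputFiltration g hg).le n) (hX n).comap_le hind hf]
  · congr 1
    have : (fun ω : ℕ → 𝒳 => if g (ω n) = j then (1 : ℝ≥0∞) else 0) =
        ((fun ω : ℕ → 𝒳 => ω n) ⁻¹' (g ⁻¹' {j})).indicator 1 := by
      classical
      funext ω
      simp [Set.indicator_apply]
    have hj : MeasurableSet (g ⁻¹' {j}) := hg (measurableSet_singleton j)
    rw [this, lintegral_indicator_one (measurable_pi_apply n hj),
      ← Measure.map_apply (measurable_pi_apply n) hj, Measure.infinitePi_map_eval]
  · exact (Measurable.of_discrete (f := fun i : Fin (L + 1) =>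
      if i = j then (1 : ℝ≥0∞) else 0)).comp (comap_measurable _)

/-- Integrating out the next output. -/
theorem lintegral_output_eq_sum {n : ℕ} {h : Fin (L + 1) → (ℕ → 𝒳) → ℝ≥0∞}
    (hh : ∀ j, Measurable[outputFiltration g hg n] (h j)) :
    ∫⁻ ω, h (g (ω n)) ω ∂(Measure.infinitePi Q) =
      ∫⁻ ω, ∑ j, h j ω * Q n (g ⁻¹' {j}) ∂(Measure.infinitePi Q) := by
  have h1 : ∀ ω : ℕ → 𝒳, h (g (ω n)) ω = ∑ j, h j ω * (if g (ω n) = j then 1 else 0) := by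
    intro ω; simp
  have hm : ∀ j, Measurable (h j) := fun j => (hh j).mono ((outputFiltration g hg).le n) le_rfl
  have hm' : ∀ j, Measurable fun ω : ℕ → 𝒳 => if g (ω n) = j then (1 : ℝ≥0∞) else 0 := fun j =>
    (Measurable.of_discrete (f := fun i : Fin (L + 1) => if i = j then (1 : ℝ≥0∞) else 0)).comp
      (hg.comp (measurable_pi_apply n))
  simp_rw [h1]
  rw [lintegral_finsetSum (f := fun j ω => h j ω * if g (ω n) = j then 1 else 0) _
      fun j _ => (hm j).mul (hm' j),
    lintegral_finsetSum (f := fun j ω => h j ω * Q n (g ⁻¹' {j})) _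
      fun j _ => (hm j).mul_const _]
  refine Finset.sum_congr rfl fun j _ => ?_
  rw [lintegral_mul_indicator_output hg Q (hh j), lintegral_mul_const _ (hm j)]

include hg in
theorem infinitePi_outputs_preimage_singleton (n : ℕ) (y : Fin n → Fin (L + 1)) :
    Measure.infinitePi Q (outputs g n ⁻¹' {y}) = ∏ i : Fin n, Q i (g ⁻¹' {y i}) := by
  have h : outputs g n ⁻¹' {y} = Set.pi (Finset.range n : Set ℕ)
      (fun s => if hs : s < n then g ⁻¹' {y ⟨s, hs⟩} else Set.univ) := by
    ext ω
    simp only [Set.mem_preimage, Set.mem_singleton_iff, Set.mem_pi, Finset.coe_range, Set.mem_Iio]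
    refine ⟨fun h s hs => ?_, fun h => funext fun i => ?_⟩
    · simp [hs, ← h, outputs]
    · simpa [outputs] using h i i.2
  rw [h, Measure.infinitePi_pi]
  · rw [Finset.prod_range]
    simp
  · intro s hs
    rw [dif_pos (Finset.mem_range.1 hs)]
    exact hg (measurableSet_singleton _)

/-- Product laws whose output laws have bounded ratios have bounded ratios on finite horizons. -/
theorem infinitePi_le_prod_mul (Q' : ℕ → Measure 𝒳) [∀ t, IsProbabilityMeasure (Q' t)]
    (r : ℕ → ℝ≥0∞) (hr : ∀ t j, Q t (g ⁻¹' {j}) ≤ r t * Q' t (g ⁻¹' {j})) {n : ℕ}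
    {A : Set (ℕ → 𝒳)} (hA : MeasurableSet[outputFiltration g hg n] A) :
    Measure.infinitePi Q A ≤ (∏ t ∈ Finset.range n, r t) * Measure.infinitePi Q' A := by
  classical
  obtain ⟨S, rfl⟩ := eq_preimage_outputs hg hA
  have hm : Measurable (outputs g n : (ℕ → 𝒳) → _) :=
    (measurable_outputs hg n).mono ((outputFiltration g hg).le n) le_rfl
  have key : ∀ (R : ℕ → Measure 𝒳) [∀ t, IsProbabilityMeasure (R t)],
      Measure.infinitePi R (outputs g n ⁻¹' S) =
        ∑ y ∈ S.toFinite.toFinset, ∏ i : Fin n, R i (g ⁻¹' {y i}) := by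
    intro R _
    rw [← Finset.sum_congr rfl fun y _ => infinitePi_outputs_preimage_singleton hg R n y,
      sum_measure_preimage_singleton _ fun y _ => hm (measurableSet_singleton y)]
    simp
  rw [key Q, key Q', Finset.mul_sum]
  refine Finset.sum_le_sum fun y _ => ?_
  rw [Finset.prod_range, ← Finset.prod_mul_distrib]
  exact Finset.prod_le_prod' fun i _ => hr _ _

end Product

/-! ### First hitting times and tail sums -/

section ENat

/-- The first time at which a property holds is at most `n` iff the property holds by time `n`. -/
theorem iInf_natCast_le_iff {p : ℕ → Prop} {n : ℕ} :
    ⨅ (k : ℕ) (_ : p k), (k : ℕ∞) ≤ n ↔ ∃ k ≤ n, p k := by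
  refine ⟨fun h => ?_, fun ⟨k, hk, hp⟩ => (iInf₂_le k hp).trans (by exact_mod_cast hk)⟩
  by_contra! hn
  have h1 : ((n + 1 : ℕ) : ℕ∞) ≤ ⨅ (k : ℕ) (_ : p k), (k : ℕ∞) :=
    le_iInf₂ fun k hk => by
      have : n + 1 ≤ k := by by_contra h'; exact hn k (by omega) hk
      exact_mod_cast this
  have h2 : n + 1 ≤ n := by exact_mod_cast h1.trans h
  omega

theorem of_iInf_natCast_eq {p : ℕ → Prop} {n : ℕ}
    (h : ⨅ (k : ℕ) (_ : p k), (k : ℕ∞) = n) : p n := by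
  obtain ⟨k, hk, hp⟩ := iInf_natCast_le_iff.1 h.le
  have : (n : ℕ∞) ≤ k := h ▸ iInf₂_le k hp
  have : n ≤ k := by exact_mod_cast this
  rwa [le_antisymm this hk]

theorem not_of_lt_iInf_natCast {p : ℕ → Prop} {n : ℕ}
    (h : (n : ℕ∞) < ⨅ (k : ℕ) (_ : p k), (k : ℕ∞)) : ¬ p n :=
  fun hp => h.not_ge (iInf₂_le n hp)

/-- Tail sum bound along an arithmetic progression. -/
theorem toENNReal_le_add_tsum (x : ℕ∞) (a : ℕ) {m : ℕ} (hm : 1 ≤ m) :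
    (x : ℝ≥0∞) ≤ a + ∑' j : ℕ, if ((a + j * m : ℕ) : ℕ∞) < x then (m : ℝ≥0∞) else 0 := by
  induction x with
  | top =>
    have : ∑' _ : ℕ, (m : ℝ≥0∞) = ⊤ := ENNReal.tsum_const_eq_top_of_ne_zero (by simp; omega)
    refine le_of_le_of_eq le_top (Eq.symm ?_)
    simp only [ENat.natCast_lt_top, if_true, this, add_top]
  | coe n =>
    -- When `a < n`, these are exactly the indices with `a + j * m < n`; blocks of length `m`
    -- starting there cover everything from `a` to `n`.
    have h1 : ∀ j ∈ Finset.range ((n - a - 1) / m + 1), n ≤ a ∨ a + j * m < n := by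
      intro j hj
      rw [Finset.mem_range, Nat.lt_succ_iff, Nat.le_div_iff_mul_le (by omega)] at hj
      omega
    by_cases hn : n ≤ a
    · exact le_add_right (by simpa using hn)
    · refine le_trans ?_ (add_le_add_right (ENNReal.sum_le_tsum
        (Finset.range ((n - a - 1) / m + 1))) _)
      rw [Finset.sum_congr rfl fun j hj => if_pos (by
        have := (h1 j hj).resolve_left hn
        exact_mod_cast this)]
      simp only [Finset.sum_const, Finset.card_range, nsmul_eq_mul, ENat.toENNReal_coe]
      have h2 := Nat.lt_mul_div_succ (n - a - 1) (show 0 < m by omega)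
      have h3 : n ≤ a + ((n - a - 1) / m + 1) * m := by
        rw [mul_comm m] at h2; omega
      exact_mod_cast h3

theorem sum_indicator_lt_le (x : ℕ∞) (n : ℕ) :
    ∑ k ∈ Finset.range n, (if (k : ℕ∞) < x then (1 : ℝ≥0∞) else 0) ≤ x := by
  induction x with
  | top => simp
  | coe m =>
    rw [← Finset.sum_filter, Finset.sum_const, nsmul_eq_mul, mul_one, ENat.toENNReal_coe]
    have h : (Finset.range n).filter (fun k : ℕ => (k : ℕ∞) < (m : ℕ∞)) ⊆ Finset.range m := by
      intro k hk
      have := (Finset.mem_filter.1 hk).2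
      exact Finset.mem_range.2 (by exact_mod_cast this)
    exact_mod_cast (Finset.card_le_card h).trans (Finset.card_range m).le

end ENat

/-! ### Optional stopping and Markov-type bounds -/

section Stopping

variable {𝒳 : Type*} [MeasurableSpace 𝒳] {L : ℕ} {g : 𝒳 → Fin (L + 1)} {hg : Measurable g}
  {μ : Measure (ℕ → 𝒳)} {τ : (ℕ → 𝒳) → ℕ∞}

/-- Optional stopping for a nonnegative process whose drift is at most `b`. -/
theorem lintegral_add_mul_measure_stoppingTime_le
    (hτ : IsStoppingTime (outputFiltration g hg) τ) (hpos : ∀ ω, 0 < τ ω)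
    {Z : ℕ → (ℕ → 𝒳) → ℝ≥0∞} (hZ : ∀ n, Measurable (Z n)) {b K : ℝ≥0∞}
    (hstep : ∀ n A, MeasurableSet[outputFiltration g hg n] A →
      ∫⁻ ω in A, Z (n + 1) ω ∂μ ≤ ∫⁻ ω in A, Z n ω ∂μ + b * μ A)
    (hK : ∀ (n : ℕ) ω, τ ω = n → K ≤ Z n ω) (n : ℕ) :
    ∫⁻ ω in {ω | (n : ℕ∞) < τ ω}, Z n ω ∂μ + K * μ {ω | τ ω ≤ n} ≤
      ∫⁻ ω, Z 0 ω ∂μ + b * ∑ k ∈ Finset.range n, μ {ω | (k : ℕ∞) < τ ω} := by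
  induction n with
  | zero =>
    have h0 : {ω | τ ω ≤ ((0 : ℕ) : ℕ∞)} = ∅ := by
      ext ω; simpa using (hpos ω).ne'
    rw [h0]
    simpa using setLIntegral_le_lintegral {ω | 0 < τ ω} (Z 0)
  | succ n ih =>
    have hm : ∀ n : ℕ, MeasurableSet {ω | (n : ℕ∞) < τ ω} := fun n =>
      (outputFiltration g hg).le n _ (measurableSet_lt_stoppingTime hg hτ n)
    have hm' : ∀ n : ℕ, MeasurableSet {ω | τ ω ≤ (n : ℕ∞)} := fun n =>
      (outputFiltration g hg).le n _ (hτ n)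
    have heq : MeasurableSet {ω | τ ω = ((n + 1 : ℕ) : ℕ∞)} := by
      have : {ω | τ ω = ((n + 1 : ℕ) : ℕ∞)} =
          {ω | τ ω ≤ ((n + 1 : ℕ) : ℕ∞)} \ {ω | τ ω ≤ (n : ℕ∞)} := by
        ext ω
        simp only [Set.mem_ofPred_eq, Set.mem_sdiff]
        induction τ ω with
        | top => simpa using (ENat.natCast_ne_top (n + 1)).symm
        | coe k => norm_cast; omega
      rw [this]
      exact (hm' _).diff (hm' _)
    have hsplit : {ω | (n : ℕ∞) < τ ω} =
        {ω | ((n + 1 : ℕ) : ℕ∞) < τ ω} ∪ {ω | τ ω = ((n + 1 : ℕ) : ℕ∞)} := by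
      ext ω
      simp only [Set.mem_ofPred_eq, Set.mem_union]
      induction τ ω with
      | top => simp [ENat.natCast_lt_top]
      | coe k => norm_cast; omega
    have hsplit' : {ω | τ ω ≤ ((n + 1 : ℕ) : ℕ∞)} =
        {ω | τ ω ≤ (n : ℕ∞)} ∪ {ω | τ ω = ((n + 1 : ℕ) : ℕ∞)} := by
      ext ω
      simp only [Set.mem_ofPred_eq, Set.mem_union]
      induction τ ω with
      | top => simpa using (ENat.natCast_ne_top (n + 1)).symm
      | coe k => norm_cast; omega
    -- Paths that stop at time `n + 1` leave the integral of `Z`, but each carries at least `K`,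
    -- which pays for the growth of the term `K * μ {τ ≤ n}`.
    have h1 : K * μ {ω | τ ω = ((n + 1 : ℕ) : ℕ∞)} ≤
        ∫⁻ ω in {ω | τ ω = ((n + 1 : ℕ) : ℕ∞)}, Z (n + 1) ω ∂μ := by
      rw [← setLIntegral_const]
      exact setLIntegral_mono (hZ _) fun ω hω => hK _ ω hω
    have h2 : ∫⁻ ω in {ω | (n : ℕ∞) < τ ω}, Z (n + 1) ω ∂μ =
        ∫⁻ ω in {ω | ((n + 1 : ℕ) : ℕ∞) < τ ω}, Z (n + 1) ω ∂μ +
          ∫⁻ ω in {ω | τ ω = ((n + 1 : ℕ) : ℕ∞)}, Z (n + 1) ω ∂μ := by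
      rw [hsplit]
      refine lintegral_union heq (Set.disjoint_left.2 fun ω h h' => ?_)
      simp only [Set.mem_ofPred_eq] at h h'
      exact h.ne' h'
    have h3 : K * μ {ω | τ ω ≤ ((n + 1 : ℕ) : ℕ∞)} ≤
        K * μ {ω | τ ω ≤ (n : ℕ∞)} + K * μ {ω | τ ω = ((n + 1 : ℕ) : ℕ∞)} := by
      rw [hsplit', ← mul_add]
      gcongr
      exact measure_union_le _ _
    calc _ ≤ ∫⁻ ω in {ω | ((n + 1 : ℕ) : ℕ∞) < τ ω}, Z (n + 1) ω ∂μ +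
          (K * μ {ω | τ ω ≤ (n : ℕ∞)} +
            ∫⁻ ω in {ω | τ ω = ((n + 1 : ℕ) : ℕ∞)}, Z (n + 1) ω ∂μ) := by
          gcongr
          exact h3.trans (by gcongr)
      _ = ∫⁻ ω in {ω | (n : ℕ∞) < τ ω}, Z (n + 1) ω ∂μ + K * μ {ω | τ ω ≤ (n : ℕ∞)} := by
          rw [h2]; ring
      _ ≤ ∫⁻ ω in {ω | (n : ℕ∞) < τ ω}, Z n ω ∂μ + b * μ {ω | (n : ℕ∞) < τ ω} +
            K * μ {ω | τ ω ≤ (n : ℕ∞)} := by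
          gcongr
          exact hstep n _ (measurableSet_lt_stoppingTime hg hτ n)
      _ = ∫⁻ ω in {ω | (n : ℕ∞) < τ ω}, Z n ω ∂μ + K * μ {ω | τ ω ≤ (n : ℕ∞)} +
            b * μ {ω | (n : ℕ∞) < τ ω} := by ring
      _ ≤ _ := by
          rw [Finset.sum_range_succ, mul_add, ← add_assoc]
          gcongr

theorem measure_stoppingTime_lt_top_le {K : ℝ≥0∞}
    (h : ∀ n : ℕ, μ {ω | τ ω ≤ n} ≤ K) : μ {ω | τ ω < ⊤} ≤ K := by
  have hU : {ω | τ ω < ⊤} = ⋃ n : ℕ, {ω | τ ω ≤ (n : ℕ∞)} := by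
    ext ω
    simp only [Set.mem_ofPred_eq, Set.mem_iUnion]
    induction τ ω with
    | top => simp
    | coe k => exact ⟨fun _ => ⟨k, le_rfl⟩, fun _ => ENat.natCast_lt_top k⟩
  have hmono : Monotone fun n : ℕ => {ω | τ ω ≤ (n : ℕ∞)} := fun a b hab ω hω =>
    le_trans (show τ ω ≤ a from hω) (by exact_mod_cast hab)
  rw [hU, hmono.measure_iUnion]
  exact iSup_le h

theorem mul_measure_lt_le_lintegral_sub {A : Set (ℕ → 𝒳)} (hA : MeasurableSet A)
    (hτ : IsStoppingTime (outputFiltration g hg) τ) (T m : ℕ) :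
    ((m : ℝ≥0∞) + 1) * μ (A ∩ {ω | ((T + m : ℕ) : ℕ∞) < τ ω}) ≤
      ∫⁻ ω in A, ((τ ω : ℝ≥0∞) - (T : ℝ≥0∞)) ∂μ := by
  have hm : MeasurableSet {ω | ((T + m : ℕ) : ℕ∞) < τ ω} :=
    (outputFiltration g hg).le _ _ (measurableSet_lt_stoppingTime hg hτ _)
  refine le_trans ?_ (lintegral_mono_set (Set.inter_subset_left
    (t := {ω | ((T + m : ℕ) : ℕ∞) < τ ω})))
  rw [← setLIntegral_const]
  refine setLIntegral_mono' (hA.inter hm) fun ω hω => ?_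
  have h := hω.2
  rw [Set.mem_ofPred_eq] at h
  generalize τ ω = x at h
  induction x with
  | top => simp
  | coe k =>
    have hk : T + m < k := by exact_mod_cast h
    rw [ENat.toENNReal_coe]
    refine ENNReal.le_sub_of_add_le_right (ENNReal.natCast_ne_top T) ?_
    exact_mod_cast (by omega : m + 1 + T ≤ k)

end Stopping

/-! ### The worst-case delay tested on events of the past -/

section Delay

variable {𝒳 : Type*} [MeasurableSpace 𝒳] {L : ℕ} (P : Fin (L + 1) → Measure 𝒳)
  [∀ i, IsProbabilityMeasure (P i)] (g : 𝒳 → Fin (L + 1)) (hg : Measurable g)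
  (θ : Fin (L + 1)) (τ : (ℕ → 𝒳) → ℕ∞)

instance (T : ℕ) : IsProbabilityMeasure (changeLaw P θ T) := by
  unfold changeLaw; infer_instance

instance : IsProbabilityMeasure (iidLaw P θ) := by
  unfold iidLaw; infer_instance

theorem changeLaw_one : changeLaw P θ 1 = iidLaw P θ := by
  simp [changeLaw, iidLaw]

theorem changeLaw_zero : changeLaw P θ 0 = iidLaw P θ := by
  simp [changeLaw, iidLaw]

theorem setLIntegral_le_worstDelay {T : ℕ} (hT : 1 ≤ T) {A : Set (ℕ → 𝒳)}
    (hA : MeasurableSet[outputFiltration g hg T] A) :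
    ∫⁻ ω in A, ((τ ω : ℝ≥0∞) - (T : ℝ≥0∞)) ∂(changeLaw P θ T) ≤
      worstDelay P g hg θ τ * changeLaw P θ T A := by
  rw [← setLIntegral_condLExp ((outputFiltration g hg).le T) _ _ hA, ← setLIntegral_const]
  refine lintegral_mono_ae (ae_restrict_of_ae ?_)
  filter_upwards [ENNReal.ae_le_essSup (μ := changeLaw P θ T)
    (condLExp (outputFiltration g hg T) (changeLaw P θ T)
        (fun ω => (τ ω : ℝ≥0∞) - (T : ℝ≥0∞)))] with ω hω
  exact hω.trans (le_iSup₂ (f := fun (T : ℕ) (_ : 1 ≤ T) =>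
    essSup (condLExp (outputFiltration g hg T) (changeLaw P θ T)
        (fun ω => (τ ω : ℝ≥0∞) - (T : ℝ≥0∞))) (changeLaw P θ T)) T hT)

/-- The conditional expectation is measurable at time `T`, so comparing integrals over all events of
time `T` gives an almost sure bound for the trimmed measure, hence for the law itself. -/
theorem worstDelay_le {K : ℝ≥0∞} (h : ∀ (T : ℕ) (A : Set (ℕ → 𝒳)), 1 ≤ T →
    MeasurableSet[outputFiltration g hg T] A →
    ∫⁻ ω in A, ((τ ω : ℝ≥0∞) - (T : ℝ≥0∞)) ∂(changeLaw P θ T) ≤ K * changeLaw P θ T A) :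
    worstDelay P g hg θ τ ≤ K := by
  refine iSup₂_le fun T hT => essSup_le_of_ae_le _ ?_
  have hle := (outputFiltration g hg).le T
  refine ae_le_of_ae_le_trim (hm := hle)
    (ae_le_of_forall_setLIntegral_le_of_sigmaFinite (measurable_condLExp _ _ _) ?_)
  intro A hA _
  rw [setLIntegral_condLExp_trim hle _ _ hA, setLIntegral_const, trim_measurableSet_eq hle hA]
  exact h T A hT hA

end Delay

/-! ### The wealth as a supermartingale under no change -/

section Wealth

variable {𝒳 : Type*} {L : ℕ} {g : 𝒳 → Fin (L + 1)} {sel : (Fin (L + 1) → ℝ) → Fin (L + 1)}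

theorem empirical_congr {k n : ℕ} {ω ω' : ℕ → 𝒳} (h : ∀ s < n, g (ω s) = g (ω' s)) :
    empirical g k n ω = empirical g k n ω' := by
  funext m
  unfold empirical
  rw [Finset.filter_congr fun s hs => by rw [h s (Finset.mem_Ico.1 hs).2]]

theorem payoff_congr {k t : ℕ} {ω ω' : ℕ → 𝒳} (h : ∀ s < t + 1, g (ω s) = g (ω' s)) :
    payoff g sel k t ω = payoff g sel k t ω' := by
  unfold payoff
  rw [h t (by omega), empirical_congr fun s hs => h s (by omega)]

theorem wealth_congr {k n : ℕ} {ω ω' : ℕ → 𝒳} (h : ∀ s < n, g (ω s) = g (ω' s)) :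
    wealth g sel k n ω = wealth g sel k n ω' := by
  unfold wealth
  congr 1
  funext l
  refine Finset.prod_congr rfl fun t ht => ?_
  rw [payoff_congr fun s hs => h s (by have := (Finset.mem_Ico.1 ht).2; omega)]

theorem abs_payoff_le (k t : ℕ) (ω : ℕ → 𝒳) : |payoff g sel k t ω| ≤ 1 := by
  unfold payoff
  split_ifs <;> norm_num

theorem one_add_mul_payoff_nonneg {l : ℝ} (hl : l ∈ Set.Icc (-1 : ℝ) 0) (k t : ℕ) (ω : ℕ → 𝒳) :
    0 ≤ 1 + l * payoff g sel k t ω := by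
  have h := abs_le.1 (abs_payoff_le (g := g) (sel := sel) k t ω)
  nlinarith [hl.1, hl.2]

/-- The wealth at time `n` of the bettor that always bets `l`. -/
noncomputable def betProduct (g : 𝒳 → Fin (L + 1)) (sel : (Fin (L + 1) → ℝ) → Fin (L + 1)) (k n : ℕ)
    (ω : ℕ → 𝒳) (l : ℝ) : ℝ :=
  ∏ t ∈ Finset.Ico k n, (1 + l * payoff g sel k t ω)

theorem continuous_betProduct (k n : ℕ) (ω : ℕ → 𝒳) : Continuous (betProduct g sel k n ω) := by
  unfold betProduct
  fun_prop

theorem betProduct_nonneg {l : ℝ} (hl : l ∈ Set.Icc (-1 : ℝ) 0) (k n : ℕ) (ω : ℕ → 𝒳) :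
    0 ≤ betProduct g sel k n ω l :=
  Finset.prod_nonneg fun t _ => one_add_mul_payoff_nonneg hl k t ω

theorem betProduct_succ {k n : ℕ} (hk : k ≤ n) (ω : ℕ → 𝒳) (l : ℝ) :
    betProduct g sel k (n + 1) ω l =
      betProduct g sel k n ω l * (1 + l * payoff g sel k n ω) :=
  Finset.prod_Ico_succ_top hk _

theorem wealth_eq (k n : ℕ) (ω : ℕ → 𝒳) :
    wealth g sel k n ω = ∫ l in (-1 : ℝ)..0, betProduct g sel k n ω l := rfl

theorem wealth_self (k : ℕ) (ω : ℕ → 𝒳) : wealth g sel k k ω = 1 := by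
  simp [wealth]

/-- The wealth at time `n + 1` if the next output is `j`. -/
noncomputable def nextWealth (g : 𝒳 → Fin (L + 1)) (sel : (Fin (L + 1) → ℝ) → Fin (L + 1)) (k n : ℕ)
    (j : Fin (L + 1)) (ω : ℕ → 𝒳) : ℝ :=
  ∫ l in (-1 : ℝ)..0, betProduct g sel k n ω l *
    (1 + l * ((if j = 0 then 1 else 0) - (if j = sel (empirical g k n ω) then 1 else 0)))

theorem wealth_succ {k n : ℕ} (hk : k ≤ n) (ω : ℕ → 𝒳) :
    wealth g sel k (n + 1) ω = nextWealth g sel k n (g (ω n)) ω := by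
  simp_rw [wealth_eq, betProduct_succ hk]
  rfl

theorem nextWealth_congr {k n : ℕ} {ω ω' : ℕ → 𝒳} (j : Fin (L + 1))
    (h : ∀ s < n, g (ω s) = g (ω' s)) :
    nextWealth g sel k n j ω = nextWealth g sel k n j ω' := by
  have hb : betProduct g sel k n ω = betProduct g sel k n ω' := by
    funext l
    refine Finset.prod_congr rfl fun t ht => ?_
    rw [payoff_congr fun s hs => h s (by have := (Finset.mem_Ico.1 ht).2; omega)]
  unfold nextWealth
  rw [hb, empirical_congr h]

theorem nextWealth_nonneg (k n : ℕ) (j : Fin (L + 1)) (ω : ℕ → 𝒳) :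
    0 ≤ nextWealth g sel k n j ω := by
  refine intervalIntegral.integral_nonneg (by norm_num) fun l hl =>
    mul_nonneg (betProduct_nonneg hl k n ω) ?_
  obtain ⟨h1, h2⟩ := hl
  split_ifs <;> norm_num <;> linarith

/-- Under a law for which the output `0` is the most likely one, the expected wealth does not
increase. -/
theorem sum_nextWealth_mul_le (k n : ℕ) (ω : ℕ → 𝒳) {p : Fin (L + 1) → ℝ}
    (hp : ∑ j, p j = 1) (h0 : ∀ j, p j ≤ p 0) :
    ∑ j, nextWealth g sel k n j ω * p j ≤ wealth g sel k n ω := by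
  have hc := continuous_betProduct (g := g) (sel := sel) k n ω
  have hsum : ∑ j, nextWealth g sel k n j ω * p j = ∫ l in (-1 : ℝ)..0,
      betProduct g sel k n ω l * (1 + l * (p 0 - p (sel (empirical g k n ω)))) := by
    unfold nextWealth
    simp_rw [← intervalIntegral.integral_mul_const]
    rw [← intervalIntegral.integral_finsetSum]
    · refine intervalIntegral.integral_congr fun l _ => ?_
      simp only [mul_assoc, ← Finset.mul_sum, add_mul, one_mul, Finset.sum_add_distrib, hp]
      simp [sub_mul, Finset.sum_sub_distrib]
    · intro j _
      exact Continuous.intervalIntegrable (by fun_prop) _ _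
  rw [hsum, wealth_eq]
  refine intervalIntegral.integral_mono_on (by norm_num)
    (Continuous.intervalIntegrable (by fun_prop) _ _) (hc.intervalIntegrable _ _) fun l hl => ?_
  have h1 := betProduct_nonneg (g := g) (sel := sel) hl k n ω
  -- The mean of the next factor is at most `1` for each bet because `l ≤ 0`, whichever label was
  -- selected.
  have h2 : l * (p 0 - p (sel (empirical g k n ω))) ≤ 0 :=
    mul_nonpos_of_nonpos_of_nonneg hl.2 (sub_nonneg.2 (h0 _))
  nlinarith

variable [MeasurableSpace 𝒳] (hg : Measurable g)

theorem setLIntegral_wealth_succ_le (Q : ℕ → Measure 𝒳) [∀ t, IsProbabilityMeasure (Q t)]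
    {k n : ℕ} (hk : k ≤ n) (h0 : ∀ j, Q n (g ⁻¹' {j}) ≤ Q n (g ⁻¹' {0})) {A : Set (ℕ → 𝒳)}
    (hA : MeasurableSet[outputFiltration g hg n] A) :
    ∫⁻ ω in A, ENNReal.ofReal (wealth g sel k (n + 1) ω) ∂(Measure.infinitePi Q) ≤
      ∫⁻ ω in A, ENNReal.ofReal (wealth g sel k n ω) ∂(Measure.infinitePi Q) := by
  have hA' := (outputFiltration g hg).le n A hA
  rw [← lintegral_indicator hA', ← lintegral_indicator hA']
  have h1 : ∀ ω : ℕ → 𝒳, A.indicator (fun ω => ENNReal.ofReal (wealth g sel k (n + 1) ω)) ω =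
      A.indicator (fun ω' => ENNReal.ofReal (nextWealth g sel k n (g (ω n)) ω')) ω := by
    intro ω
    by_cases h : ω ∈ A <;> simp [h, wealth_succ hk]
  simp_rw [h1]
  rw [lintegral_output_eq_sum hg Q
    (h := fun j => A.indicator fun ω' => ENNReal.ofReal (nextWealth g sel k n j ω'))
    fun j => (measurable_of_outputs hg fun ω ω' h => by rw [nextWealth_congr j h]).indicator hA]
  refine lintegral_mono fun ω => ?_
  by_cases h : ω ∈ A
  · simp only [h, Set.indicator_of_mem]
    have h2 : ∀ j, Q n (g ⁻¹' {j}) = ENNReal.ofReal ((Q n).real (g ⁻¹' {j})) := fun j => by simp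
    simp_rw [h2, ← ENNReal.ofReal_mul (nextWealth_nonneg _ _ _ _)]
    rw [← ENNReal.ofReal_sum_of_nonneg fun j _ =>
      mul_nonneg (nextWealth_nonneg _ _ _ _) measureReal_nonneg]
    refine ENNReal.ofReal_le_ofReal (sum_nextWealth_mul_le k n ω ?_ fun j => ?_)
    · have : ∑ j, Q n (g ⁻¹' {j}) = 1 := by
        rw [sum_measure_preimage_singleton _ fun j _ => hg (measurableSet_singleton j)]
        simp
      simp_rw [measureReal_def]
      rw [← ENNReal.toReal_sum fun j _ => measure_ne_top _ _, this, ENNReal.toReal_one]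
    · exact ENNReal.toReal_mono (measure_ne_top _ _) (h0 j)
  · simp [h]

end Wealth

/-! ### Exponential growth of the wealth after the change -/

section Growth

variable {𝒳 : Type*} {g : 𝒳 → Fin 2} {sel : (Fin 2 → ℝ) → Fin 2}

/-- The number of outputs equal to `j` among those with indices in `[k, n)`. -/
def outputCount (g : 𝒳 → Fin 2) (k n : ℕ) (ω : ℕ → 𝒳) (j : Fin 2) : ℕ :=
  ((Finset.Ico k n).filter fun s => g (ω s) = j).card

theorem outputCount_succ {k n : ℕ} (hk : k ≤ n) (ω : ℕ → 𝒳) (j : Fin 2) :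
    outputCount g k (n + 1) ω j = outputCount g k n ω j + if g (ω n) = j then 1 else 0 := by
  unfold outputCount
  rw [← Finset.insert_Ico_right_eq_Ico_add_one hk, Finset.filter_insert]
  split_ifs
  · rw [Finset.card_insert_of_notMem (by simp)]
  · rfl

theorem outputCount_le_of_sel_eq_zero (hsel : IsArgmaxRule (L := 1) sel) {k n : ℕ} {ω : ℕ → 𝒳}
    (h : sel (empirical (L := 1) g k n ω) = 0) :
    outputCount g k n ω 1 ≤ outputCount g k n ω 0 := by
  have h1 := hsel (empirical (L := 1) g k n ω) 1
  rw [h] at h1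
  unfold empirical at h1
  by_cases hn : n ≤ k
  · simp [outputCount, Finset.Ico_eq_empty_of_le hn]
  · have hpos : (0 : ℝ) < n - k := by
      rw [sub_pos]; exact_mod_cast not_le.1 hn
    rw [if_neg hn, if_neg hn, div_le_div_iff_of_pos_right hpos] at h1
    exact_mod_cast h1

/-- The rounds in which the bettor abstains cost at most one factor per output `0`. -/
theorem pow_mul_pow_le_betProduct (hsel : IsArgmaxRule (L := 1) sel) {k n : ℕ} (hk : k ≤ n)
    (ω : ℕ → 𝒳) {l : ℝ} (hl : l ∈ Set.Icc (-1 : ℝ) 0) :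
    (1 + l) ^ outputCount g k n ω 0 ≤ betProduct (L := 1) g sel k n ω l ∧
    (1 - l) ^ outputCount g k n ω 1 * (1 + l) ^ outputCount g k n ω 0 ≤
      betProduct (L := 1) g sel k n ω l * (1 - l) ^ (outputCount g k n ω 0 + 1) := by
  have hv0 : 0 ≤ 1 + l := by linarith [hl.1]
  have hv1 : 1 + l ≤ 1 := by linarith [hl.2]
  have hu1 : 1 ≤ 1 - l := by linarith [hl.2]
  induction n, hk using Nat.le_induction with
  | base => simpa [outputCount, betProduct] using hl.2
  | succ n hk ih =>
    obtain ⟨h1, h2⟩ := ih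
    have hp := betProduct_nonneg (L := 1) (g := g) (sel := sel) hl k n ω
    have hle := outputCount_le_of_sel_eq_zero (g := g) hsel (k := k) (n := n) (ω := ω)
    have hpu : 0 ≤ betProduct (L := 1) g sel k n ω l * (1 - l) ^ (outputCount g k n ω 0 + 1) := by
      positivity
    rw [betProduct_succ (L := 1) hk, outputCount_succ hk, outputCount_succ hk]
    unfold payoff
    generalize betProduct (L := 1) g sel k n ω l = p at *
    generalize outputCount g k n ω 0 = a at *
    generalize outputCount g k n ω 1 = b at *
    have hY : g (ω n) = 0 ∨ g (ω n) = 1 := by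
      rcases g (ω n) with ⟨i, hi⟩; interval_cases i <;> simp
    have hS : sel (empirical (L := 1) g k n ω) = 0 ∨ sel (empirical (L := 1) g k n ω) = 1 := by
      rcases sel (empirical (L := 1) g k n ω) with ⟨i, hi⟩; interval_cases i <;> simp
    have hva : 0 ≤ (1 + l) ^ a := by positivity
    have hvb : 0 ≤ (1 - l) ^ b * (1 + l) ^ a := by positivity
    rcases hY with hY | hY <;> rcases hS with hS | hS
    · simp only [hY, hS]
      norm_num
      rw [pow_succ (1 + l) a, pow_succ (1 - l) (a + 1), ← mul_assoc, ← mul_assoc]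
      exact ⟨by nlinarith, by nlinarith⟩
    · simp only [hY, hS]
      norm_num
      rw [pow_succ (1 + l) a, pow_succ (1 - l) (a + 1), ← mul_assoc]
      exact ⟨by nlinarith, by
        nlinarith [mul_le_mul_of_nonneg_right h2 hv0, mul_nonneg hpu hv0]⟩
    · simp only [hY, hS]
      norm_num
      refine ⟨h1, ?_⟩
      -- This is a missed win: label `1` appears while the bettor abstains. Abstaining means that
      -- ones do not outnumber zeros, so the crude bound `(1 + l) ^ a ≤ p` suffices; the extra `1`
      -- in the exponent absorbs the current round.
      rw [mul_comm p]
      exact mul_le_mul (pow_le_pow_right₀ hu1 (by have := hle hS; omega)) h1 hva (by positivity)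
    · simp only [hY, hS]
      norm_num
      rw [← sub_eq_add_neg, pow_succ (1 - l) b]
      exact ⟨by nlinarith, by nlinarith [mul_le_mul_of_nonneg_right h2 (zero_le_one.trans hu1)]⟩

/-- A product of weights that bounds the inverse of the wealth. -/
noncomputable def decay (g : 𝒳 → Fin 2) (k n : ℕ) (ω : ℕ → 𝒳) : ℝ :=
  ∏ t ∈ Finset.Ico k n, if g (ω t) = 1 then 4 / 5 else 13 / 7

theorem decay_eq (k n : ℕ) (ω : ℕ → 𝒳) :
    decay g k n ω = (4 / 5) ^ outputCount g k n ω 1 * (13 / 7) ^ outputCount g k n ω 0 := by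
  have h : ∀ i : Fin 2, i = 0 ↔ ¬ i = 1 := by decide
  unfold decay outputCount
  rw [Finset.prod_ite, Finset.prod_const, Finset.prod_const]
  simp_rw [h]

theorem decay_pos (k n : ℕ) (ω : ℕ → 𝒳) : 0 < decay g k n ω := by
  rw [decay_eq]; positivity

/-- Only bets in `[-3/10, -1/4]` are kept from the mixture. The constant is `26 = 20 * (13/10)`: the
inverse length of that interval times the one spare factor `1 - l ≤ 13/10`. -/
theorem one_le_wealth_mul_decay (hsel : IsArgmaxRule (L := 1) sel) {k n : ℕ} (hk : k ≤ n)
    (ω : ℕ → 𝒳) : 1 ≤ 26 * wealth (L := 1) g sel k n ω * decay g k n ω := by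
  have hD := decay_pos (g := g) k n ω
  -- Here `1 - l` lies in `[5/4, 13/10]` and `1 + l ≥ 7/10`. A one gains at least `5/4`, and a zero
  -- costs at most `(13/10) / (7/10) = 13/7`, including the abstention it may have caused.
  have hbet : ∀ l ∈ Set.Icc (-(3 / 10) : ℝ) (-(1 / 4)),
      (decay g k n ω)⁻¹ * (10 / 13) ≤ betProduct (L := 1) g sel k n ω l := by
    intro l hl
    have hl' : l ∈ Set.Icc (-1 : ℝ) 0 := ⟨by linarith [hl.1], by linarith [hl.2]⟩
    have hu : 5 / 4 ≤ 1 - l := by linarith [hl.2]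
    have hu' : 1 - l ≤ 13 / 10 := by linarith [hl.1]
    have hv : 7 / 10 ≤ 1 + l := by linarith [hl.1]
    have hp := betProduct_nonneg (L := 1) (g := g) (sel := sel) hl' k n ω
    have h := (pow_mul_pow_le_betProduct (g := g) hsel hk ω hl').2
    rw [decay_eq]
    generalize betProduct (L := 1) g sel k n ω l = p at *
    generalize outputCount g k n ω 0 = a at *
    generalize outputCount g k n ω 1 = b at *
    have h1 : (5 / 4 : ℝ) ^ b * (7 / 10) ^ a ≤ p * (13 / 10) ^ (a + 1) :=
      calc (5 / 4 : ℝ) ^ b * (7 / 10) ^ a ≤ (1 - l) ^ b * (1 + l) ^ a := by gcongr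
        _ ≤ p * (1 - l) ^ (a + 1) := h
        _ ≤ p * (13 / 10) ^ (a + 1) := by
          have : 0 ≤ 1 - l := by linarith
          gcongr
    have h2 : ((4 / 5 : ℝ) ^ b * (13 / 7) ^ a)⁻¹ * (10 / 13) =
        (5 / 4) ^ b * (7 / 10) ^ a / (13 / 10) ^ (a + 1) := by
      rw [mul_inv, ← inv_pow, ← inv_pow, pow_succ, ← div_div, mul_div_assoc, ← div_pow]
      norm_num
      ring
    rw [h2, div_le_iff₀ (by positivity)]
    exact h1
  have hc := continuous_betProduct (L := 1) (g := g) (sel := sel) k n ω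
  have hW : (decay g k n ω)⁻¹ * (10 / 13) * (1 / 20) ≤ wealth (L := 1) g sel k n ω :=
    calc (decay g k n ω)⁻¹ * (10 / 13) * (1 / 20) =
          ∫ _ in (-(3 / 10) : ℝ)..(-(1 / 4)), (decay g k n ω)⁻¹ * (10 / 13) := by
          rw [intervalIntegral.integral_const, smul_eq_mul]; ring
      _ ≤ ∫ l in (-(3 / 10) : ℝ)..(-(1 / 4)), betProduct (L := 1) g sel k n ω l :=
          intervalIntegral.integral_mono_on (by norm_num) (by simp)
            (hc.intervalIntegrable _ _) hbet
      _ ≤ wealth (L := 1) g sel k n ω := by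
          refine intervalIntegral.integral_mono_interval (by norm_num) (by norm_num) (by norm_num)
            ?_ (hc.intervalIntegrable _ _)
          refine (ae_restrict_iff' measurableSet_Ioc).2 (.of_forall fun l hl => ?_)
          exact betProduct_nonneg (Set.Ioc_subset_Icc_self hl) k n ω
  calc (1 : ℝ) = 26 * ((decay g k n ω)⁻¹ * (10 / 13) * (1 / 20)) * decay g k n ω := by
        field_simp; norm_num
    _ ≤ _ := by gcongr

variable [MeasurableSpace 𝒳] (hg : Measurable g)

/-- After time `k` the weights contract in expectation, given the past. -/
theorem setLIntegral_decay_le (Q : ℕ → Measure 𝒳) [∀ t, IsProbabilityMeasure (Q t)] {k n : ℕ}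
    (hk : k ≤ n) (h0 : ∀ t ≥ k, Q t (g ⁻¹' {0}) = ENNReal.ofReal (1 / 10))
    (h1 : ∀ t ≥ k, Q t (g ⁻¹' {1}) = ENNReal.ofReal (9 / 10)) {A : Set (ℕ → 𝒳)}
    (hA : MeasurableSet[outputFiltration (L := 1) g hg k] A) :
    ∫⁻ ω in A, ENNReal.ofReal (decay g k n ω) ∂(Measure.infinitePi Q) ≤
      ENNReal.ofReal ((91 / 100) ^ (n - k)) * Measure.infinitePi Q A := by
  have hA' := (outputFiltration (L := 1) g hg).le k A hA
  induction n, hk using Nat.le_induction with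
  | base => simp [decay]
  | succ n hk ih =>
    have hAn := (outputFiltration (L := 1) g hg).mono hk A hA
    have hcongr : ∀ ω ω' : ℕ → 𝒳, (∀ s < n, g (ω s) = g (ω' s)) →
        decay g k n ω = decay g k n ω' := fun ω ω' h =>
      Finset.prod_congr rfl fun t ht => by rw [h t (Finset.mem_Ico.1 ht).2]
    have hstep : ∀ ω : ℕ → 𝒳, A.indicator (fun ω => ENNReal.ofReal (decay g k (n + 1) ω)) ω =
        A.indicator (fun ω' => ENNReal.ofReal (decay g k n ω' *
          if g (ω n) = 1 then 4 / 5 else 13 / 7)) ω := by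
      intro ω
      have : decay g k (n + 1) ω = decay g k n ω * if g (ω n) = 1 then 4 / 5 else 13 / 7 :=
        Finset.prod_Ico_succ_top hk _
      by_cases h : ω ∈ A <;> simp only [h, Set.indicator_of_mem, Set.indicator_of_notMem,
        not_false_eq_true, this]
    have hsum := lintegral_output_eq_sum (L := 1) hg Q (n := n)
      (h := fun j => A.indicator fun ω' => ENNReal.ofReal (decay g k n ω' *
          if j = 1 then 4 / 5 else 13 / 7))
      fun j => (measurable_of_outputs (L := 1) hg fun ω ω' h => by
        rw [hcongr ω ω' h]).indicator hAn
    rw [← lintegral_indicator hA']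
    simp_rw [hstep]
    refine hsum.trans_le ?_
    -- The mean weight is `(9/10) * (4/5) + (1/10) * (13/7)`, about `0.906`.
    calc _ ≤ ∫⁻ ω, A.indicator (fun ω => ENNReal.ofReal (91 / 100) *
          ENNReal.ofReal (decay g k n ω)) ω ∂(Measure.infinitePi Q) := by
          refine lintegral_mono fun ω => ?_
          rw [Fin.sum_univ_two]
          have hd := (decay_pos (g := g) k n ω).le
          by_cases h : ω ∈ A
          · simp only [h, Set.indicator_of_mem]
            rw [h0 n hk, h1 n hk, ← ENNReal.ofReal_mul (by split_ifs <;> positivity),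
              ← ENNReal.ofReal_mul (by split_ifs <;> positivity),
              ← ENNReal.ofReal_mul (by norm_num),
              ← ENNReal.ofReal_add (by split_ifs <;> positivity) (by split_ifs <;> positivity)]
            refine ENNReal.ofReal_le_ofReal ?_
            norm_num
            linarith
          · simp [h]
      _ = ENNReal.ofReal (91 / 100) *
          ∫⁻ ω in A, ENNReal.ofReal (decay g k n ω) ∂(Measure.infinitePi Q) := by
          rw [lintegral_indicator hA', lintegral_const_mul]
          exact ((measurable_of_outputs (L := 1) hg fun ω ω' h => by rw [hcongr ω ω' h]).mono
            ((outputFiltration (L := 1) g hg).le n) le_rfl)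
      _ ≤ ENNReal.ofReal (91 / 100) *
          (ENNReal.ofReal ((91 / 100) ^ (n - k)) * Measure.infinitePi Q A) := by gcongr
      _ = _ := by
          rw [← mul_assoc, ← ENNReal.ofReal_mul (by norm_num), ← pow_succ',
            Nat.sub_add_comm hk]

end Growth

/-! ### Delay upper bound, change of measure, and lower bounds -/

section Bounds

variable {𝒳 : Type*} [MeasurableSpace 𝒳] {P : Fin 2 → Measure 𝒳} [∀ i, IsProbabilityMeasure (P i)]
  {g : 𝒳 → Fin 2} (hg : Measurable g) {sel : (Fin 2 → ℝ) → Fin 2} {α : ℝ}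

theorem measure_preimage_eq_outputProb (θ m : Fin 2) :
    P θ (g ⁻¹' {m}) = ENNReal.ofReal (outputProb (L := 1) P g θ m) := by
  simp [outputProb]

/-- The rate works because `12 * (9/100) > 1`. After this many steps the expected decay has
cancelled the threshold `1/α`. -/
theorem pow_ceil_le {α : ℝ} (hα : 0 < α) (hL : 20 ≤ Real.log (1 / α)) :
    (91 / 100 : ℝ) ^ ⌈12 * Real.log (1 / α)⌉₊ ≤ α := by
  set n := ⌈12 * Real.log (1 / α)⌉₊
  have h1 : (91 / 100 : ℝ) ≤ Real.exp (-(9 / 100)) := by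
    have := Real.add_one_le_exp (-(9 / 100) : ℝ); linarith
  have h2 : 12 * Real.log (1 / α) ≤ n := Nat.le_ceil _
  calc (91 / 100 : ℝ) ^ n ≤ Real.exp (-(9 / 100)) ^ n := by gcongr
    _ = Real.exp (n * -(9 / 100)) := (Real.exp_nat_mul _ _).symm
    _ ≤ Real.exp (-Real.log (1 / α)) := Real.exp_le_exp.2 (by linarith)
    _ = α := by rw [one_div, Real.log_inv, neg_neg, Real.exp_log hα]

/-- A stopping rule that stops once the wealth started after time `T` is large is fast after a
change at time `T`. -/
theorem setLIntegral_sub_le (hp : outputProb (L := 1) P g 1 = ![1 / 10, 9 / 10])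
    (hsel : IsArgmaxRule (L := 1) sel) (hα : 0 < α) (hL : 20 ≤ Real.log (1 / α))
    {τ : (ℕ → 𝒳) → ℕ∞} {T : ℕ}
    (hτ : ∀ m ω, 1 ≤ m → ((T + m : ℕ) : ℕ∞) < τ ω → wealth (L := 1) g sel T (T + m) ω < 1 / α)
    {A : Set (ℕ → 𝒳)} (hA : MeasurableSet[outputFiltration (L := 1) g hg T] A) :
    ∫⁻ ω in A, ((τ ω : ℝ≥0∞) - (T : ℝ≥0∞)) ∂(changeLaw (L := 1) P 1 T) ≤
      ENNReal.ofReal (27 * Real.log (1 / α)) * changeLaw (L := 1) P 1 T A := by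
  set n := ⌈12 * Real.log (1 / α)⌉₊ with hn
  have hn1 : 1 ≤ n := Nat.one_le_iff_ne_zero.2 (by rw [hn, Ne, Nat.ceil_eq_zero]; linarith)
  -- The first `n` steps are given away. If `τ` exceeds `T + n + j`, the wealth is still below
  -- `1/α`, so `one_le_wealth_mul_decay` forces the `j`-th summand to be at least `1`.
  have hpt : ∀ ω, (τ ω : ℝ≥0∞) - T ≤
      n + ∑' j : ℕ, ENNReal.ofReal (26 / α * decay g T (T + (n + j)) ω) := by
    intro ω
    rw [tsub_le_iff_left, ← add_assoc]
    have h := toENNReal_le_add_tsum (τ ω) (T + n) le_rfl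
    rw [Nat.cast_add] at h
    refine h.trans (add_le_add_right (ENNReal.tsum_le_tsum fun j => ?_) _)
    split_ifs with hj
    · rw [mul_one, add_assoc] at hj
      have h1 := hτ _ ω (by omega) hj
      have h2 := one_le_wealth_mul_decay (g := g) hsel (Nat.le_add_right T (n + j)) ω
      have h3 := decay_pos (g := g) T (T + (n + j)) ω
      rw [Nat.cast_one, ← ENNReal.ofReal_one]
      refine ENNReal.ofReal_le_ofReal (h2.trans ?_)
      rw [div_eq_mul_one_div]
      gcongr
    · exact zero_le
  have hmeas : ∀ j, Measurable fun ω : ℕ → 𝒳 =>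
      ENNReal.ofReal (26 / α * decay g T (T + (n + j)) ω) := fun j =>
    (measurable_of_outputs (L := 1) hg (n := T + (n + j)) fun ω ω' h => by
      have : decay g T (T + (n + j)) ω = decay g T (T + (n + j)) ω' :=
        Finset.prod_congr rfl fun t ht => by rw [h t (Finset.mem_Ico.1 ht).2]
      rw [this]).mono ((outputFiltration (L := 1) g hg).le _) le_rfl
  have hdec : ∀ j, ∫⁻ ω in A, ENNReal.ofReal (26 / α * decay g T (T + (n + j)) ω)
      ∂(changeLaw (L := 1) P 1 T) ≤
      ENNReal.ofReal (26 * (91 / 100) ^ j) * changeLaw (L := 1) P 1 T A := by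
    intro j
    -- Coordinates `t ≥ T` are the observations from time `T + 1` on: post-change and independent of
    -- `A`. The case `T = 0` is the i.i.d. law needed for the test.
    have hQ : ∀ t ≥ T, (if t + 1 < T then (0 : Fin 2) else 1) = 1 := fun t ht =>
      if_neg (by omega)
    have h := setLIntegral_decay_le hg (fun t : ℕ => P (if t + 1 < T then 0 else 1))
      (Nat.le_add_right T (n + j))
      (fun t ht => by rw [hQ t ht, measure_preimage_eq_outputProb, hp]; rfl)
      (fun t ht => by rw [hQ t ht, measure_preimage_eq_outputProb, hp]; rfl) hA
    rw [Nat.add_sub_cancel_left] at h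
    simp_rw [ENNReal.ofReal_mul (show 0 ≤ 26 / α by positivity)]
    rw [lintegral_const_mul' _ _ ENNReal.ofReal_ne_top]
    refine (mul_le_mul_right h _).trans ?_
    rw [← mul_assoc, ← ENNReal.ofReal_mul (by positivity)]
    refine mul_le_mul_left (ENNReal.ofReal_le_ofReal ?_) _
    calc 26 / α * (91 / 100 : ℝ) ^ (n + j)
        ≤ 26 / α * (α * (91 / 100) ^ j) := by
          rw [pow_add]
          gcongr
          exact pow_ceil_le hα hL
      _ = 26 * (91 / 100) ^ j := by field_simp
  have hgeom : ∑' j : ℕ, ENNReal.ofReal (26 * (91 / 100) ^ j) = ENNReal.ofReal (26 / (9 / 100)) := by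
    rw [← ENNReal.ofReal_tsum_of_nonneg (fun j => by positivity)
      ((summable_geometric_of_lt_one (by norm_num) (by norm_num)).mul_left _), tsum_mul_left,
      tsum_geometric_of_lt_one (by norm_num) (by norm_num)]
    norm_num
  calc _ ≤ ∫⁻ ω in A, (n + ∑' j : ℕ, ENNReal.ofReal (26 / α * decay g T (T + (n + j)) ω))
        ∂(changeLaw (L := 1) P 1 T) := lintegral_mono hpt
    _ = n * changeLaw (L := 1) P 1 T A + ∑' j : ℕ, ∫⁻ ω in A,
        ENNReal.ofReal (26 / α * decay g T (T + (n + j)) ω) ∂(changeLaw (L := 1) P 1 T) := by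
        rw [lintegral_add_left measurable_const, setLIntegral_const,
          lintegral_tsum fun j => (hmeas j).aemeasurable]
    _ ≤ n * changeLaw (L := 1) P 1 T A + ∑' j : ℕ,
        ENNReal.ofReal (26 * (91 / 100) ^ j) * changeLaw (L := 1) P 1 T A := by
        gcongr with j
        exact hdec j
    _ = ENNReal.ofReal (n + 26 / (9 / 100)) * changeLaw (L := 1) P 1 T A := by
        rw [ENNReal.tsum_mul_right, hgeom, ← add_mul,
          ENNReal.ofReal_add (by positivity) (by positivity), ENNReal.ofReal_natCast]
    _ ≤ _ := by
        gcongr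
        -- It remains that `1 + 26 / (9/100) < 290` is at most `15 * log (1 / α)`, which holds as
        -- the logarithm is at least `20`.
        have := Nat.ceil_lt_add_one (show 0 ≤ 12 * Real.log (1 / α) by linarith)
        rw [← hn] at this
        linarith

/-! ### Change of measure -/

theorem prod_range_ite_lt (c : ℝ≥0∞) (S n : ℕ) :
    ∏ t ∈ Finset.range (S + n), (if t + 1 < S + 1 then 1 else c) = c ^ n := by
  rw [Finset.prod_range_add, Finset.prod_eq_one fun t ht => if_pos (by
    have := Finset.mem_range.1 ht; omega), one_mul]
  simp

/-- The output likelihood ratio is at most `e`, since `9/10 ≤ e * exp (-1)` and `1/10 ≤ e - 1`. The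
exponent is `m + 1` because the observation at time `T` is already post-change. -/
theorem changeLaw_le_exp_mul_iidLaw
    (hp0 : outputProb (L := 1) P g 0 = ![1 - Real.exp (-1), Real.exp (-1)])
    (hp1 : outputProb (L := 1) P g 1 = ![1 / 10, 9 / 10]) {T m : ℕ} (hT : 1 ≤ T)
    {A : Set (ℕ → 𝒳)} (hA : MeasurableSet[outputFiltration (L := 1) g hg (T + m)] A) :
    changeLaw (L := 1) P 1 T A ≤
      ENNReal.ofReal (Real.exp (m + 1)) * iidLaw (L := 1) P 0 A := by
  obtain ⟨S, rfl⟩ := Nat.exists_eq_add_of_le' hT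
  have h := infinitePi_le_prod_mul (L := 1) hg (fun t : ℕ => P (if t + 1 < S + 1 then 0 else 1))
    (fun _ => P 0) (fun t => if t + 1 < S + 1 then 1 else ENNReal.ofReal (Real.exp 1)) ?_ hA
  · rw [add_assoc, add_comm 1 m, prod_range_ite_lt, ← ENNReal.ofReal_pow (Real.exp_pos _).le,
      ← Real.exp_nat_mul] at h
    simpa [changeLaw, iidLaw] using h
  · intro t j
    split_ifs
    · simp
    · have he := Real.add_one_le_exp (1 : ℝ)
      have hee : Real.exp 1 * Real.exp (-1) = 1 := by rw [← Real.exp_add]; simp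
      rw [measure_preimage_eq_outputProb, measure_preimage_eq_outputProb, hp0, hp1,
        ← ENNReal.ofReal_mul (Real.exp_pos _).le]
      refine ENNReal.ofReal_le_ofReal ?_
      fin_cases j <;> simp <;> nlinarith

/-- Up to time `T` the two laws differ only in the observation at time `T`, and each output has
post-change probability at least `1/10`. -/
theorem iidLaw_le_mul_changeLaw
    (hp1 : outputProb (L := 1) P g 1 = ![1 / 10, 9 / 10]) {T : ℕ} (hT : 1 ≤ T)
    {A : Set (ℕ → 𝒳)} (hA : MeasurableSet[outputFiltration (L := 1) g hg T] A) :
    iidLaw (L := 1) P 0 A ≤ 10 * changeLaw (L := 1) P 1 T A := by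
  obtain ⟨S, rfl⟩ := Nat.exists_eq_add_of_le' hT
  have h := infinitePi_le_prod_mul (L := 1) hg (fun _ => P 0)
    (fun t : ℕ => P (if t + 1 < S + 1 then 0 else 1))
    (fun t => if t + 1 < S + 1 then 1 else 10) ?_ hA
  · rwa [prod_range_ite_lt, pow_one] at h
  · intro t j
    split_ifs
    · simp
    · refine prob_le_one.trans ?_
      rw [measure_preimage_eq_outputProb, hp1, show (10 : ℝ≥0∞) = ENNReal.ofReal 10 by simp,
        ← ENNReal.ofReal_mul (by norm_num), ← ENNReal.ofReal_one]
      refine ENNReal.ofReal_le_ofReal ?_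
      fin_cases j <;> norm_num

/-! ### Lower bounds -/

/-- With `m` about half of `log (1 / α)`, stopping by time `1 + m` has probability at most `exp (m +
1) * α ≤ 1/2` under `P 1`, so the mean is at least `(m + 1) / 2`. -/
theorem log_div_four_le_lintegral_of_isLevelTest
    (hp0 : outputProb (L := 1) P g 0 = ![1 - Real.exp (-1), Real.exp (-1)])
    (hp1 : outputProb (L := 1) P g 1 = ![1 / 10, 9 / 10]) (hα : 0 < α)
    (hL : 20 ≤ Real.log (1 / α)) {τ : (ℕ → 𝒳) → ℕ∞} (hτ : IsLevelTest (L := 1) P g hg α τ) :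
    ENNReal.ofReal (Real.log (1 / α) / 4) ≤ ∫⁻ ω, (τ ω : ℝ≥0∞) ∂(iidLaw (L := 1) P 1) := by
  obtain ⟨hst, hfa⟩ := hτ
  set m := ⌊Real.log (1 / α) / 2⌋₊
  have hm : (m : ℝ) ≤ Real.log (1 / α) / 2 := Nat.floor_le (by linarith)
  have hm' : Real.log (1 / α) / 2 < m + 1 := Nat.lt_floor_add_one _
  have hs : iidLaw (L := 1) P 1 {ω | τ ω ≤ ((1 + m : ℕ) : ℕ∞)} ≤ ENNReal.ofReal (1 / 2) := by
    have h := changeLaw_le_exp_mul_iidLaw hg hp0 hp1 le_rfl (hst (1 + m))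
    rw [changeLaw_one] at h
    refine h.trans ((mul_le_mul_right ((measure_mono fun ω hω => ?_).trans hfa) _).trans ?_)
    · exact lt_of_le_of_lt hω (ENat.natCast_lt_top _)
    · rw [← ENNReal.ofReal_mul (Real.exp_pos _).le]
      refine ENNReal.ofReal_le_ofReal ?_
      have hα' : α = Real.exp (-Real.log (1 / α)) := by
        rw [one_div, Real.log_inv, neg_neg, Real.exp_log hα]
      calc Real.exp (m + 1) * α = Real.exp (m + 1 + -Real.log (1 / α)) := by
            rw [Real.exp_add _ (-Real.log (1 / α)), ← hα']
        _ ≤ Real.exp (-1) := Real.exp_le_exp.2 (by linarith)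
        _ ≤ 1 / 2 := by
            rw [Real.exp_neg, ← one_div]
            exact one_div_le_one_div_of_le (by norm_num)
              (by linarith [Real.add_one_le_exp (1 : ℝ)])
  have hl : ENNReal.ofReal (1 / 2) ≤ iidLaw (L := 1) P 1 {ω | ((1 + m : ℕ) : ℕ∞) < τ ω} := by
    have hc : {ω | ((1 + m : ℕ) : ℕ∞) < τ ω} = {ω | τ ω ≤ ((1 + m : ℕ) : ℕ∞)}ᶜ := by
      ext ω; simp
    have hms : MeasurableSet {ω | τ ω ≤ ((1 + m : ℕ) : ℕ∞)} :=
      (outputFiltration (L := 1) g hg).le _ _ (hst (1 + m))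
    rw [hc, prob_compl_eq_one_sub hms]
    refine le_trans (le_of_eq ?_) (tsub_le_tsub_left hs 1)
    rw [← ENNReal.ofReal_one, ← ENNReal.ofReal_sub _ (by norm_num)]
    norm_num
  have h := mul_measure_lt_le_lintegral_sub (μ := iidLaw (L := 1) P 1) MeasurableSet.univ hst 1 m
  rw [Set.univ_inter, Measure.restrict_univ] at h
  refine le_trans ?_ ((h.trans (lintegral_mono fun ω => tsub_le_self)))
  refine le_trans ?_ (mul_le_mul_right hl _)
  rw [show (m : ℝ≥0∞) + 1 = ENNReal.ofReal (m + 1) by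
    rw [ENNReal.ofReal_add (by positivity) (by norm_num)]; simp,
    ← ENNReal.ofReal_mul (by positivity)]
  exact ENNReal.ofReal_le_ofReal (by linarith)

/-- Used with `x = log (1 / α)`: the left side bounds the run length of a detector that is too fast,
the right side is the required `1/α`. Dividing by `exp (x / 2)` reduces it to `30 * x + 1 < exp (x /
2)`. -/
theorem one_add_mul_exp_lt_exp {x : ℝ} (hx : 20 ≤ x) :
    1 + 20 * (x / 2) * Real.exp (x / 2 + 1) < Real.exp x := by
  have he : (2 : ℝ) ≤ Real.exp 1 := by linarith [Real.add_one_le_exp (1 : ℝ)]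
  have he' : Real.exp 1 ≤ 3 := by linarith [Real.exp_one_lt_d9]
  have h1 : (2 : ℝ) ^ 10 * (x / 2 - 9) ≤ Real.exp (x / 2) := by
    have : Real.exp (x / 2) = Real.exp 1 ^ 10 * Real.exp (x / 2 - 10) := by
      rw [← Real.exp_nat_mul, ← Real.exp_add]; norm_num
    rw [this]
    have := Real.add_one_le_exp (x / 2 - 10)
    gcongr
    · linarith
    · linarith
  have h2 : Real.exp x = Real.exp (x / 2) * Real.exp (x / 2) := by
    rw [← Real.exp_add]; ring_nf
  rw [h2, Real.exp_add]
  set E := Real.exp (x / 2)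
  have hE : 30 * x + 1 < E := by norm_num at h1; linarith
  have : 20 * (x / 2) * (E * Real.exp 1) ≤ 20 * (x / 2) * (E * 3) := by
    gcongr
  nlinarith

/-- If the conditional delay is short, then the stopping time occurs in each window with
probability bounded below when there is no change. -/
theorem iidLaw_lt_add_le
    (hp0 : outputProb (L := 1) P g 0 = ![1 - Real.exp (-1), Real.exp (-1)])
    (hp1 : outputProb (L := 1) P g 1 = ![1 / 10, 9 / 10]) {τ : (ℕ → 𝒳) → ℕ∞}
    (hst : IsStoppingTime (outputFiltration (L := 1) g hg) τ) {m : ℕ}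
    (hd : worstDelay (L := 1) P g hg 1 τ ≤ ((m : ℝ≥0∞) + 1) / 2) {n : ℕ} (hn : 1 ≤ n) :
    iidLaw (L := 1) P 0 {ω | ((n + m : ℕ) : ℕ∞) < τ ω} ≤
      (1 - (ENNReal.ofReal (20 * Real.exp (m + 1)))⁻¹) *
        iidLaw (L := 1) P 0 {ω | (n : ℕ∞) < τ ω} := by
  set A : Set (ℕ → 𝒳) := {ω | (n : ℕ∞) < τ ω}
  set D : Set (ℕ → 𝒳) := {ω | ((n + m : ℕ) : ℕ∞) < τ ω}
  have hA := measurableSet_lt_stoppingTime (L := 1) hg hst n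
  have hD := measurableSet_lt_stoppingTime (L := 1) hg hst (n + m)
  have hA' := (outputFiltration (L := 1) g hg).le _ _ hA
  have hD' := (outputFiltration (L := 1) g hg).le _ _ hD
  have hAm := (outputFiltration (L := 1) g hg).mono (Nat.le_add_right n m) _ hA
  have hDA : D ⊆ A := fun ω hω =>
    lt_of_le_of_lt (b := ((n + m : ℕ) : ℕ∞)) (by exact_mod_cast Nat.le_add_right n m) hω
  have hB := @MeasurableSet.diff _ (outputFiltration (L := 1) g hg (n + m)) _ _ hAm hD
  -- Markov's inequality for a change at time `n`, on the past event that no alarm has been raised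
  -- yet.
  have h1 : changeLaw (L := 1) P 1 n D ≤ changeLaw (L := 1) P 1 n A / 2 := by
    have h2 := (mul_measure_lt_le_lintegral_sub (μ := changeLaw (L := 1) P 1 n) hA' hst n m).trans
      ((setLIntegral_le_worstDelay (L := 1) P g hg 1 τ hn hA).trans (mul_le_mul_left hd _))
    rw [Set.inter_eq_right.2 hDA, ENNReal.mul_comm_div] at h2
    exact (ENNReal.mul_le_mul_iff_right (by simp) (by finiteness)).1 h2
  have h2 : changeLaw (L := 1) P 1 n A / 2 ≤ changeLaw (L := 1) P 1 n (A \ D) := by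
    rw [measure_sdiff hDA hD'.nullMeasurableSet (measure_ne_top _ _)]
    refine le_trans (le_of_eq ?_) (tsub_le_tsub_left h1 _)
    rw [ENNReal.sub_half (measure_ne_top _ _)]
  -- The measure is changed twice: `A` belongs to time `n` and costs a factor `10`, while `A \ D`
  -- belongs to time `n + m` and costs `exp (m + 1)`. The remaining factor `2` comes from Markov.
  have h3 : iidLaw (L := 1) P 0 A ≤
      ENNReal.ofReal (20 * Real.exp (m + 1)) * iidLaw (L := 1) P 0 (A \ D) :=
    calc iidLaw (L := 1) P 0 A ≤ 10 * changeLaw (L := 1) P 1 n A :=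
          iidLaw_le_mul_changeLaw hg hp1 hn hA
      _ = 20 * (changeLaw (L := 1) P 1 n A / 2) := by
          rw [div_eq_mul_inv, mul_comm _ (2 : ℝ≥0∞)⁻¹, ← mul_assoc,
            show (20 : ℝ≥0∞) = 10 * 2 by norm_num, mul_assoc (10 : ℝ≥0∞),
            ENNReal.mul_inv_cancel (by norm_num) (by norm_num), mul_one]
      _ ≤ 20 * (ENNReal.ofReal (Real.exp (m + 1)) * iidLaw (L := 1) P 0 (A \ D)) := by
          gcongr
          exact h2.trans (changeLaw_le_exp_mul_iidLaw hg hp0 hp1 hn hB)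
      _ = _ := by
          rw [ENNReal.ofReal_mul (by norm_num), mul_assoc]; simp
  have hc0 : ENNReal.ofReal (20 * Real.exp (m + 1)) ≠ 0 := by
    rw [Ne, ENNReal.ofReal_eq_zero, not_le]; positivity
  have h4 : (ENNReal.ofReal (20 * Real.exp (m + 1)))⁻¹ * iidLaw (L := 1) P 0 A ≤
      iidLaw (L := 1) P 0 (A \ D) := by
    rwa [mul_comm, ← div_eq_mul_inv, ENNReal.div_le_iff' hc0 ENNReal.ofReal_ne_top]
  have h5 : iidLaw (L := 1) P 0 D = iidLaw (L := 1) P 0 A - iidLaw (L := 1) P 0 (A \ D) := by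
    rw [← measure_sdiff Set.sdiff_subset (hA'.diff hD').nullMeasurableSet (measure_ne_top _ _),
      Set.sdiff_sdiff_cancel_left hDA]
  rw [h5, ENNReal.sub_mul fun _ _ => measure_ne_top _ _, one_mul]
  exact tsub_le_tsub_left h4 _

theorem log_div_four_le_worstDelay_of_isChangeDetector
    (hp0 : outputProb (L := 1) P g 0 = ![1 - Real.exp (-1), Real.exp (-1)])
    (hp1 : outputProb (L := 1) P g 1 = ![1 / 10, 9 / 10]) (hα : 0 < α)
    (hL : 20 ≤ Real.log (1 / α)) {τ : (ℕ → 𝒳) → ℕ∞}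
    (hτ : IsChangeDetector (L := 1) P g hg α τ) :
    ENNReal.ofReal (Real.log (1 / α) / 4) ≤ worstDelay (L := 1) P g hg 1 τ := by
  obtain ⟨hst, harl⟩ := hτ
  by_contra! hlt
  set m := ⌊Real.log (1 / α) / 2⌋₊
  have hm : (m : ℝ) ≤ Real.log (1 / α) / 2 := Nat.floor_le (by linarith)
  have hm' : Real.log (1 / α) / 2 < m + 1 := Nat.lt_floor_add_one _
  have hm1 : 1 ≤ m := Nat.le_floor (by rw [Nat.cast_one]; linarith)
  have hd : worstDelay (L := 1) P g hg 1 τ ≤ ((m : ℝ≥0∞) + 1) / 2 := by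
    refine hlt.le.trans ?_
    rw [show ((m : ℝ≥0∞) + 1) / 2 = ENNReal.ofReal ((m + 1) / 2) by
      rw [ENNReal.ofReal_div_of_pos (by norm_num),
        ENNReal.ofReal_add (by positivity) (by norm_num)]; simp]
    exact ENNReal.ofReal_le_ofReal (by linarith)
  set c := ENNReal.ofReal (20 * Real.exp (m + 1)) with hc
  -- Windows start at time `1` because changes occur at `T ≥ 1`. The resulting geometric tail gives
  -- mean at most `1 + m * c`.
  have hgeo : ∀ j : ℕ, iidLaw (L := 1) P 0 {ω | ((1 + j * m : ℕ) : ℕ∞) < τ ω} ≤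
      (1 - c⁻¹) ^ j := by
    intro j
    induction j with
    | zero => simpa using prob_le_one
    | succ j ih =>
      have h := iidLaw_lt_add_le hg hp0 hp1 hst hd (show 1 ≤ 1 + j * m by omega)
      rw [add_mul, one_mul, ← add_assoc, pow_succ']
      exact h.trans (mul_le_mul_right ih _)
  have hm2 : ∀ j : ℕ, MeasurableSet {ω | ((1 + j * m : ℕ) : ℕ∞) < τ ω} := fun j =>
    (outputFiltration (L := 1) g hg).le _ _ (measurableSet_lt_stoppingTime (L := 1) hg hst _)
  have hup : averageRunLength (L := 1) P τ ≤ 1 + m * c := by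
    calc averageRunLength (L := 1) P τ ≤ ∫⁻ ω, (1 + ∑' j : ℕ,
          {ω | ((1 + j * m : ℕ) : ℕ∞) < τ ω}.indicator (fun _ => (m : ℝ≥0∞)) ω)
          ∂(iidLaw (L := 1) P 0) := by
          refine lintegral_mono fun ω => ?_
          have h := toENNReal_le_add_tsum (τ ω) 1 hm1
          rw [Nat.cast_one] at h
          refine h.trans (le_of_eq ?_)
          classical
          simp [Set.indicator_apply]
      _ = 1 + ∑' j : ℕ, m * iidLaw (L := 1) P 0 {ω | ((1 + j * m : ℕ) : ℕ∞) < τ ω} := by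
          rw [lintegral_add_left measurable_const, lintegral_tsum fun j =>
            (measurable_const.indicator (hm2 j)).aemeasurable]
          simp_rw [lintegral_indicator_const (hm2 _)]
          simp
      _ ≤ 1 + ∑' j : ℕ, m * (1 - c⁻¹) ^ j := by
          gcongr with j
          exact hgeo j
      _ = 1 + m * (1 - (1 - c⁻¹))⁻¹ := by
          rw [ENNReal.tsum_mul_left, ENNReal.tsum_geometric]
      _ = 1 + m * c := by
          rw [ENNReal.sub_sub_cancel ENNReal.one_ne_top, inv_inv]
          rw [ENNReal.inv_le_one, hc, ← ENNReal.ofReal_one]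
          refine ENNReal.ofReal_le_ofReal ?_
          have := Real.add_one_le_exp ((m : ℝ) + 1)
          have : (0 : ℝ) ≤ m := by positivity
          linarith
  have hfin := harl.trans hup
  rw [show (1 : ℝ≥0∞) + m * c = ENNReal.ofReal (1 + m * (20 * Real.exp (m + 1))) by
    rw [ENNReal.ofReal_add (by norm_num) (by positivity), ENNReal.ofReal_mul (by positivity)]
    simp [hc], ENNReal.ofReal_le_ofReal_iff (by positivity)] at hfin
  have hexp : Real.exp (Real.log (1 / α)) = 1 / α := Real.exp_log (by positivity)
  have hlt' := one_add_mul_exp_lt_exp hL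
  rw [hexp] at hlt'
  have hmono : (m : ℝ) * (20 * Real.exp (m + 1)) ≤
      Real.log (1 / α) / 2 * (20 * Real.exp (Real.log (1 / α) / 2 + 1)) := by
    gcongr
  linarith

end Bounds

/-! ### Error control and speed of the proposed test and detector -/

section Proposed

variable {𝒳 : Type*} {g : 𝒳 → Fin 2} {sel : (Fin 2 → ℝ) → Fin 2} {α : ℝ}

theorem proposedTest_le_iff {n : ℕ} {ω : ℕ → 𝒳} :
    proposedTest (L := 1) g sel α ω ≤ n ↔
      ∃ k ≤ n, 1 ≤ k ∧ 1 / α ≤ wealth (L := 1) g sel 0 k ω :=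
  iInf_natCast_le_iff

theorem proposedDetector_le_iff {n : ℕ} {ω : ℕ → 𝒳} :
    proposedDetector (L := 1) g sel α ω ≤ n ↔
      ∃ k ≤ n, 1 ≤ k ∧ 1 / α ≤ ⨆ i : Fin k, wealth (L := 1) g sel i k ω :=
  iInf_natCast_le_iff

theorem proposedTest_pos (ω : ℕ → 𝒳) : 0 < proposedTest (L := 1) g sel α ω := by
  by_contra! h
  obtain ⟨k, hk, hk1, -⟩ := (proposedTest_le_iff (n := 0)).1 (by simpa using h)
  omega

theorem proposedDetector_pos (ω : ℕ → 𝒳) : 0 < proposedDetector (L := 1) g sel α ω := by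
  by_contra! h
  obtain ⟨k, hk, hk1, -⟩ := (proposedDetector_le_iff (n := 0)).1 (by simpa using h)
  omega

variable [MeasurableSpace 𝒳] {P : Fin 2 → Measure 𝒳} [∀ i, IsProbabilityMeasure (P i)]
  (hg : Measurable g)

theorem isStoppingTime_proposedTest :
    IsStoppingTime (outputFiltration (L := 1) g hg) (proposedTest (L := 1) g sel α) := by
  intro n
  refine measurableSet_of_outputs (L := 1) hg fun ω ω' h => ?_
  refine proposedTest_le_iff.trans (Iff.trans ?_ proposedTest_le_iff.symm)
  refine exists_congr fun k => and_congr_right fun hk => ?_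
  rw [wealth_congr (L := 1) fun s hs => h s (hs.trans_le hk)]

theorem isStoppingTime_proposedDetector :
    IsStoppingTime (outputFiltration (L := 1) g hg) (proposedDetector (L := 1) g sel α) := by
  intro n
  refine measurableSet_of_outputs (L := 1) hg fun ω ω' h => ?_
  refine proposedDetector_le_iff.trans (Iff.trans ?_ proposedDetector_le_iff.symm)
  refine exists_congr fun k => and_congr_right fun hk => ?_
  simp_rw [wealth_congr (L := 1) (g := g) (sel := sel) (n := k)
    fun s hs => h s (hs.trans_le hk)]

include hg in
theorem measurable_ofReal_wealth (k n : ℕ) :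
    Measurable fun ω : ℕ → 𝒳 => ENNReal.ofReal (wealth (L := 1) g sel k n ω) :=
  (measurable_of_outputs (L := 1) hg (n := n) fun ω ω' h => by rw [wealth_congr (L := 1) h]).mono
    ((outputFiltration (L := 1) g hg).le n) le_rfl

theorem measure_preimage_le_zero
    (hp0 : outputProb (L := 1) P g 0 = ![1 - Real.exp (-1), Real.exp (-1)]) (j : Fin 2) :
    P 0 (g ⁻¹' {j}) ≤ P 0 (g ⁻¹' {0}) := by
  rw [measure_preimage_eq_outputProb, measure_preimage_eq_outputProb, hp0]
  refine ENNReal.ofReal_le_ofReal ?_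
  have h : Real.exp (-1) ≤ 1 / 2 := by
    rw [Real.exp_neg, ← one_div]
    exact one_div_le_one_div_of_le (by norm_num) (by linarith [Real.add_one_le_exp (1 : ℝ)])
  fin_cases j <;> simp
  linarith

/-- Ville's inequality: the wealth starts at `1`, has drift `0` at most, and is at least `1/α` at
the stopping time. -/
theorem isLevelTest_proposedTest
    (hp0 : outputProb (L := 1) P g 0 = ![1 - Real.exp (-1), Real.exp (-1)]) (hα : 0 < α) :
    IsLevelTest (L := 1) P g hg α (proposedTest (L := 1) g sel α) := by
  have hst := isStoppingTime_proposedTest hg (sel := sel) (α := α)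
  refine ⟨hst, measure_stoppingTime_lt_top_le fun n => ?_⟩
  have h := lintegral_add_mul_measure_stoppingTime_le (μ := iidLaw (L := 1) P 0) hst
    proposedTest_pos (measurable_ofReal_wealth hg (sel := sel) 0) (b := 0)
    (K := ENNReal.ofReal (1 / α)) (fun n A hA => by
      rw [zero_mul, add_zero]
      exact setLIntegral_wealth_succ_le (L := 1) hg (fun _ => P 0) (Nat.zero_le n)
        (measure_preimage_le_zero hp0) hA)
    (fun n ω hω => ENNReal.ofReal_le_ofReal (of_iInf_natCast_eq hω).2) n
  simp only [wealth_self, ENNReal.ofReal_one, lintegral_one, measure_univ, zero_mul,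
    add_zero] at h
  have h1 := le_add_self.trans h
  rw [one_div, ENNReal.ofReal_inv_of_pos hα, mul_comm, ← div_eq_mul_inv,
    ENNReal.div_le_iff (by simpa using hα) ENNReal.ofReal_ne_top, one_mul] at h1
  exact h1

theorem isChangeDetector_proposedDetector
    (hp0 : outputProb (L := 1) P g 0 = ![1 - Real.exp (-1), Real.exp (-1)]) (hα : 0 < α) :
    IsChangeDetector (L := 1) P g hg α (proposedDetector (L := 1) g sel α) := by
  have hst := isStoppingTime_proposedDetector hg (sel := sel) (α := α)
  refine ⟨hst, ?_⟩
  set τ := proposedDetector (L := 1) g sel α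
  set K := ENNReal.ofReal (1 / α) with hK
  have hK0 : K ≠ 0 := by simpa [hK] using hα
  have hbound : ∀ n : ℕ, K * iidLaw (L := 1) P 0 {ω | τ ω ≤ n} ≤ averageRunLength (L := 1) P τ := by
    intro n
    have h := lintegral_add_mul_measure_stoppingTime_le (μ := iidLaw (L := 1) P 0) hst
      proposedDetector_pos
      -- The maximum is replaced by the sum, whose drift is controlled. Optional stopping then
      -- bounds `K` times the stopping probability by the sum of the tails of `τ`, hence by its
      -- mean.
      (Z := fun n ω => ∑ k ∈ Finset.range n, ENNReal.ofReal (wealth (L := 1) g sel k n ω))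
      (fun n => Finset.measurable_sum _ fun k _ => measurable_ofReal_wealth hg (sel := sel) k n)
      (b := 1) (K := K) (fun n A hA => ?_) (fun n ω hω => ?_) n
    · refine (le_add_self.trans h).trans ?_
      have hm : ∀ k : ℕ, MeasurableSet {ω | (k : ℕ∞) < τ ω} := fun k =>
        (outputFiltration (L := 1) g hg).le _ _ (measurableSet_lt_stoppingTime (L := 1) hg hst k)
      have hsum : ∑ k ∈ Finset.range n, iidLaw (L := 1) P 0 {ω | (k : ℕ∞) < τ ω} =
          ∫⁻ ω, ∑ k ∈ Finset.range n, {ω | (k : ℕ∞) < τ ω}.indicator 1 ω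
            ∂(iidLaw (L := 1) P 0) := by
        rw [lintegral_finsetSum _ fun k _ => measurable_one.indicator (hm k)]
        simp_rw [lintegral_indicator_one (hm _)]
      simp only [Finset.range_zero, Finset.sum_empty, lintegral_zero, zero_add, one_mul]
      rw [hsum]
      refine lintegral_mono fun ω => ?_
      classical
      simpa [Set.indicator_apply] using sum_indicator_lt_le (τ ω) n
    · have hw := measurable_ofReal_wealth hg (sel := sel)
      rw [lintegral_finsetSum _ fun k _ => hw k (n + 1), lintegral_finsetSum _ fun k _ => hw k n]
      -- The old summands do not grow in expectation; the new one, `k = n`, has wealth `1` at time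
      -- `n` and yields `b = 1`.
      calc _ ≤ ∑ k ∈ Finset.range (n + 1), ∫⁻ ω in A,
            ENNReal.ofReal (wealth (L := 1) g sel k n ω) ∂(iidLaw (L := 1) P 0) :=
            Finset.sum_le_sum fun k hk => setLIntegral_wealth_succ_le (L := 1) hg (fun _ => P 0)
              (Nat.lt_succ_iff.1 (Finset.mem_range.1 hk)) (measure_preimage_le_zero hp0) hA
        _ = _ := by
            rw [Finset.sum_range_succ]
            simp [wealth_self]
    · obtain ⟨hn, hle⟩ := of_iInf_natCast_eq hω
      have : Nonempty (Fin n) := ⟨⟨0, hn⟩⟩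
      obtain ⟨i, hi⟩ := exists_eq_ciSup_of_finite
        (f := fun i : Fin n => wealth (L := 1) g sel i n ω)
      rw [← hi] at hle
      exact (ENNReal.ofReal_le_ofReal hle).trans (Finset.single_le_sum
        (f := fun k => ENNReal.ofReal (wealth (L := 1) g sel k n ω))
        (fun _ _ => zero_le) (Finset.mem_range.2 i.2))
  -- A finite mean makes `τ` almost surely finite, so the stopping probabilities in `hbound`
  -- increase to `1`.
  by_cases hfin : averageRunLength (L := 1) P τ = ⊤
  · rw [hfin]; exact le_top
  have hae := ae_lt_top (measurable_stoppingTime (L := 1) hg hst) hfin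
  have hone : iidLaw (L := 1) P 0 {ω | τ ω < ⊤} = 1 := by
    rw [← measure_univ (μ := iidLaw (L := 1) P 0)]
    refine measure_congr ?_
    filter_upwards [hae] with ω hω
    have : τ ω < ⊤ := by simpa using hω
    exact propext ⟨fun _ => trivial, fun _ => this⟩
  have h := measure_stoppingTime_lt_top_le (μ := iidLaw (L := 1) P 0) (τ := τ)
    (K := averageRunLength (L := 1) P τ / K) fun n => by
      rw [ENNReal.le_div_iff_mul_le (.inl hK0) (.inl ENNReal.ofReal_ne_top), mul_comm]
      exact hbound n
  rw [hone, ENNReal.le_div_iff_mul_le (.inl hK0) (.inl ENNReal.ofReal_ne_top), one_mul] at h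
  exact h

theorem worstDelay_proposedDetector_le
    (hp1 : outputProb (L := 1) P g 1 = ![1 / 10, 9 / 10])
    (hsel : IsArgmaxRule (L := 1) sel) (hα : 0 < α) (hL : 20 ≤ Real.log (1 / α)) :
    worstDelay (L := 1) P g hg 1 (proposedDetector (L := 1) g sel α) ≤
      ENNReal.ofReal (27 * Real.log (1 / α)) := by
  refine worstDelay_le (L := 1) P g hg 1 _ fun T A _ hA =>
    setLIntegral_sub_le hg hp1 hsel hα hL (fun m ω hm h => ?_) hA
  have h1 := not_of_lt_iInf_natCast h
  push Not at h1
  -- The process started after time `T` is among those maximised, since `m ≥ 1`.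
  exact (le_ciSup (f := fun i : Fin (T + m) => wealth (L := 1) g sel i (T + m) ω)
    (Set.finite_range _).bddAbove ⟨T, by omega⟩).trans_lt (h1 (by omega))

include hg in
theorem lintegral_proposedTest_le
    (hp1 : outputProb (L := 1) P g 1 = ![1 / 10, 9 / 10])
    (hsel : IsArgmaxRule (L := 1) sel) (hα : 0 < α) (hL : 20 ≤ Real.log (1 / α)) :
    ∫⁻ ω, (proposedTest (L := 1) g sel α ω : ℝ≥0∞) ∂(iidLaw (L := 1) P 1) ≤
      ENNReal.ofReal (27 * Real.log (1 / α)) := by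
  have h := setLIntegral_sub_le (P := P) hg hp1 hsel hα hL
    (τ := proposedTest (L := 1) g sel α) (T := 0) (fun m ω hm h => by
      have h1 := not_of_lt_iInf_natCast h
      push Not at h1
      rw [zero_add] at h1 ⊢
      exact h1 hm) (A := Set.univ) MeasurableSet.univ
  simpa [changeLaw_zero] using h

include hg in
theorem iidLaw_proposedTest_lt_top
    (hp1 : outputProb (L := 1) P g 1 = ![1 / 10, 9 / 10])
    (hsel : IsArgmaxRule (L := 1) sel) (hα : 0 < α) (hL : 20 ≤ Real.log (1 / α)) :
    iidLaw (L := 1) P 1 {ω | proposedTest (L := 1) g sel α ω < ⊤} = 1 := by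
  have hae := ae_lt_top (measurable_stoppingTime (L := 1) hg
    (isStoppingTime_proposedTest hg (sel := sel) (α := α)))
    ((lintegral_proposedTest_le (P := P) hg hp1 hsel hα hL).trans_lt ENNReal.ofReal_lt_top).ne
  rw [← measure_univ (μ := iidLaw (L := 1) P 1)]
  refine measure_congr ?_
  filter_upwards [hae] with ω hω
  have : proposedTest (L := 1) g sel α ω < ⊤ := by simpa using hω
  exact propext ⟨fun _ => trivial, fun _ => this⟩

end Proposed

end ClassifierDetection

open ClassifierDetection
theorem mainTheorem9 :
    ∃ c C α₀ : ℝ, 0 < c ∧ 0 < C ∧ 0 < α₀ ∧ α₀ < 1 ∧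
      ∀ (𝒳 : Type*) [MeasurableSpace 𝒳] (P : Fin 2 → Measure 𝒳)
        [∀ i, IsProbabilityMeasure (P i)] (g : 𝒳 → Fin 2) (hg : Measurable g)
        (_ : outputProb (L := 1) P g 0 = ![1 - Real.exp (-1), Real.exp (-1)])
        (_ : outputProb (L := 1) P g 1 = ![1 / 10, 9 / 10])
        (sel : (Fin 2 → ℝ) → Fin 2) (_ : IsArgmaxRule (L := 1) sel)
        (Δ : ℝ) (_ : Δ = gap (L := 1) P g 1) (α : ℝ) (_ : 0 < α) (_ : α < α₀),
        -- lower bound for every change detector with false-alarm control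
        (∀ τ : (ℕ → 𝒳) → ℕ∞, IsChangeDetector (L := 1) P g hg α τ →
          ENNReal.ofReal (c * (Real.log (1 / α) / Δ ^ 2)) ≤ worstDelay (L := 1) P g hg 1 τ) ∧
        -- the delay bound is tight for the proposed detector
        IsChangeDetector (L := 1) P g hg α (proposedDetector (L := 1) g sel α) ∧
        ENNReal.ofReal (c * (Real.log (1 / (α * Δ)) / Δ ^ 2)) ≤
          worstDelay (L := 1) P g hg 1 (proposedDetector (L := 1) g sel α) ∧
        worstDelay (L := 1) P g hg 1 (proposedDetector (L := 1) g sel α) ≤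
          ENNReal.ofReal (C * (Real.log (1 / (α * Δ)) / Δ ^ 2)) ∧
        -- lower bound for every level-`α` sequential test
        (∀ τ : (ℕ → 𝒳) → ℕ∞, IsLevelTest (L := 1) P g hg α τ →
          ENNReal.ofReal (c * (Real.log (1 / α) / Δ ^ 2)) ≤
            ∫⁻ ω, (τ ω : ℝ≥0∞) ∂(iidLaw (L := 1) P 1)) ∧
        -- the bound on the expected stopping time is tight for the proposed test
        IsLevelTest (L := 1) P g hg α (proposedTest (L := 1) g sel α) ∧
        iidLaw (L := 1) P 1 {ω | proposedTest (L := 1) g sel α ω < ⊤} = 1 ∧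
        ENNReal.ofReal (c * (Real.log (1 / (α * Δ)) / Δ ^ 2)) ≤
          ∫⁻ ω, (proposedTest (L := 1) g sel α ω : ℝ≥0∞) ∂(iidLaw (L := 1) P 1) ∧
        ∫⁻ ω, (proposedTest (L := 1) g sel α ω : ℝ≥0∞) ∂(iidLaw (L := 1) P 1) ≤
          ENNReal.ofReal (C * (Real.log (1 / (α * Δ)) / Δ ^ 2)) := by 
  -- The choice of `α₀` makes `log (1 / α)` at least `20`. As the gap is `4/5`, `log (1 / (α * Δ))`
  -- exceeds it by `log (5 / 4) ≤ 1`, which the slack in `1/20` absorbs.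
  refine ⟨1 / 20, 27, Real.exp (-20), by norm_num, by norm_num, Real.exp_pos _,
    by rw [Real.exp_lt_one_iff]; norm_num, ?_⟩
  intro 𝒳 _ P _ g hg hp0 hp1 sel hsel Δ hΔ α hα hα'
  have hΔ' : Δ = 4 / 5 := by
    rw [hΔ, gap, hp1]; norm_num
  have hL : 20 ≤ Real.log (1 / α) := by
    rw [one_div, Real.log_inv, le_neg]
    exact (Real.log_le_iff_le_exp hα).2 hα'.le
  have hlog : Real.log (1 / (α * Δ)) = Real.log (1 / α) + Real.log (5 / 4) := by
    rw [← Real.log_mul (by positivity) (by norm_num), hΔ']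
    congr 1
    field_simp
  have h0 : 0 ≤ Real.log (5 / 4) := Real.log_nonneg (by norm_num)
  have h1 : Real.log (5 / 4) ≤ 1 := (Real.log_le_sub_one_of_pos (by norm_num)).trans (by norm_num)
  have hsq : ((4 : ℝ) / 5) ^ 2 = 16 / 25 := by norm_num
  rw [hlog, hΔ', hsq]
  have hlow : ENNReal.ofReal (1 / 20 * (Real.log (1 / α) / (16 / 25))) ≤
      ENNReal.ofReal (Real.log (1 / α) / 4) := ENNReal.ofReal_le_ofReal (by linarith)
  have hlow' : ENNReal.ofReal (1 / 20 * ((Real.log (1 / α) + Real.log (5 / 4)) / (16 / 25))) ≤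
      ENNReal.ofReal (Real.log (1 / α) / 4) := ENNReal.ofReal_le_ofReal (by linarith)
  have hup : ENNReal.ofReal (27 * Real.log (1 / α)) ≤
      ENNReal.ofReal (27 * ((Real.log (1 / α) + Real.log (5 / 4)) / (16 / 25))) :=
    ENNReal.ofReal_le_ofReal (by linarith)
  have hdet := isChangeDetector_proposedDetector (P := P) hg (sel := sel) hp0 hα
  have htest := isLevelTest_proposedTest (P := P) hg (sel := sel) hp0 hα
  exact ⟨fun τ hτ => hlow.trans
      (log_div_four_le_worstDelay_of_isChangeDetector hg hp0 hp1 hα hL hτ),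
    hdet,
    hlow'.trans (log_div_four_le_worstDelay_of_isChangeDetector hg hp0 hp1 hα hL hdet),
    (worstDelay_proposedDetector_le hg hp1 hsel hα hL).trans hup,
    fun τ hτ => hlow.trans (log_div_four_le_lintegral_of_isLevelTest hg hp0 hp1 hα hL hτ),
    htest,
    iidLaw_proposedTest_lt_top hg hp1 hsel hα hL,
    hlow'.trans (log_div_four_le_lintegral_of_isLevelTest hg hp0 hp1 hα hL htest),
    (lintegral_proposedTest_le hg hp1 hsel hα hL).trans hup⟩
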